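/- **Setting.** Let $X$ be a separable real Banach space and $\gamma$ a centred nondegenerate Gaussian measure on its Borel $\sigma$-algebra. Let $\mathcal H$ be the closure of $X^*$ in $L^2(X,\gamma)$, and let $H=\{\int_X x\,\hat h(x)\,d\gamma(x):\hat h\in\mathcal H\}\subset X$ be the Cameron–Martin space, with the inner product $[h,k]_H=\langle\hat h,\hat k\rangle_{L^2(X,\gamma)}$. All function spaces are complex-valued. For an open convex set $\Omega\subset X$, the Sobolev space $W^{1,2}(\Omega,\gamma)$ is the domain of the closure $\nabla_H$ of the operator $\tilde u_{|\Omega}\mapsto(\nabla_H\tilde u)_{|\Omega}$, $\tilde u$ Lipschitz on $X$, from $L^2(\Omega,\gamma)$ to $L^2(\Omega,\gamma;H_{\mathbb C})$, where $H_{\mathbb C}$ is the complexification of $H$ and $\nabla_H\tilde u$ is the ($\gamma$-a.e. defined) gradient of $\tilde u$ along $H$; its norm is $\big(\int_\Omega|u|^2d\gamma+\int_\Omega|\nabla_Hu|^2d\gamma\big)^{1/2}$. The Ornstein–Uhlenbeck operator $L$ of $\Omega$ in $L^2(\Omega,\gamma)$ is defined by: $u\in D(L)$ and $Lu=f$ iff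 $u\in W^{1,2}(\Omega,\gamma)$ and $\int_\Omega[\nabla_Hu,\overline{\nabla_Hv}]\,d\gamma=-\int_\Omega f\,\overline v\,d\gamma$ for all $v\in W^{1,2}(\Omega,\gamma)$. For an operator $A$, $\rho(A)$ is its resolvent set and $R(\lambda,A)=(\lambda-A)^{-1}$ for $\lambda\in\rho(A)$. **Proposition.** Let $\Omega\subset X$ be open and convex, and let $(\Omega_n)_{n\in\mathbb N}$ be sets of the form $\Omega_n=\pi_n^{-1}(\mathscr O_n)$, where $\pi_n$ is a continuous linear projection of $X$ onto a finite dimensional subspace $F_n$ and $\mathscr O_n\subset F_n$ is an open convex set with smooth boundary. Assume that $\Omega\subset\Omega_n$ for all $n$ and $\gamma(\Omega_n\setminus\Omega)\to0$. Let $L$ and $L_n$ be the Ornstein–Uhlenbeck operators of $\Omega$ and $\Omega_n$. (a) For every $\lambda\in\mathbb C\setminus(-\infty,0]$ we have $\lambda\in\rho(L)$ and $\lambda\in\rho(L_n)$ for all $n$, and for every $f\in L^2(X,\gamma)$ $$\big(R(\lambda,L_n)(f_{|\Omega_n})\big)_{|\Omega}\longrightarrow R(\lambda,L)(f_{|\Omega})\quad\text{in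 }W^{1,2}(\Omega,\gamma)\text{ as }n\to\infty .$$ (b) $L$ and $L_n$ generate strongly continuous semigroups $(T_t)_{t\ge0}$ on $L^2(\Omega,\gamma)$ and $(T^{(n)}_t)_{t\ge0}$ on $L^2(\Omega_n,\gamma)$, and for every $u_0\in L^2(X,\gamma)$ and every $t>0$ $$\big(T^{(n)}_t(u_{0|\Omega_n})\big)_{|\Omega}\longrightarrow T_t(u_{0|\Omega})\quad\text{in }W^{1,2}(\Omega,\gamma)\text{ as }n\to\infty .$$ -/

import Mathlib

open MeasureTheory ProbabilityTheory Filter Topology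
open scoped NNReal ContDiff InnerProductSpace

noncomputable section

namespace WienerOU

/-! ### Restriction of `L²` classes -/

/-- The class in `L²(ν)` of a function in `L²(μ)`, for `ν ≤ μ`. It is used for the restriction
`f ↦ f|_Ω` from `L²(X, γ)` or from `L²(Ω', γ)`, `Ω ⊆ Ω'`, to `L²(Ω, γ)`. -/
def restrictL2 {X : Type*} [MeasurableSpace X] {μ ν : Measure X} (h : ν ≤ μ) (f : Lp ℂ 2 μ) :
    Lp ℂ 2 ν :=
  ((Lp.memLp f).mono_measure h).toLp f

theorem pairing_integrable {X : Type*} [MeasurableSpace X] (γ : Measure X) (φ : Lp ℝ 2 γ) (g : Lp ℂ 2 γ) :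
    Integrable (fun y => (φ y : ℂ) * g y) γ :=
  MemLp.integrable_mul (p := 2) (q := 2) (Lp.memLp φ).ofReal (Lp.memLp g)

section Sobolev

variable {X : Type*} [NormedAddCommGroup X] [NormedSpace ℝ X] [MeasurableSpace X]

/-! ### The Cameron-Martin space -/

/-- The closure of the dual `X*` in the real space `L²(X, γ)`. The Cameron-Martin space `H ⊆ X` is
its image under `cmVector`, with the norm that makes `cmVector` an isometry onto `H`. -/
def reproducingSpace (γ : Measure X) : Submodule ℝ (Lp ℝ 2 γ) :=
  (Submodule.span ℝ
    {φ : Lp ℝ 2 γ | ∃ l : StrongDual ℝ X, φ =ᵐ[γ] fun x => l x}).topologicalClosure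

/-- The map `φ ↦ ∫ x φ(x) dγ(x)` (a Bochner integral), an isometry of `reproducingSpace γ` onto the
Cameron-Martin space `H`; if `h = cmVector γ φ` then `φ` is the function usually written `ĥ`. -/
def cmVector (γ : Measure X) (φ : Lp ℝ 2 γ) : X := ∫ x, φ x • x ∂γ

/-- The complexification `H_ℂ` of the Cameron-Martin space, where `H` is identified with
`reproducingSpace γ` by the isometry `h ↦ ĥ`: the closed complex span of `X*` in `L²(X, γ; ℂ)`. -/
def CameronMartinC (γ : Measure X) : Submodule ℂ (Lp ℂ 2 γ) :=
  (Submodule.span ℂ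
    {φ : Lp ℂ 2 γ | ∃ l : StrongDual ℝ X, φ =ᵐ[γ] fun x => (l x : ℂ)}).topologicalClosure

instance (γ : Measure X) : CompleteSpace (CameronMartinC γ) :=
  Submodule.topologicalClosure.completeSpace _

/-- The complex bilinear pairing `[h, g]` of `h ∈ H` (given by `φ = ĥ`) with `g ∈ H_ℂ`. -/
def pairing (γ : Measure X) (φ : Lp ℝ 2 γ) (g : CameronMartinC γ) : ℂ :=
  ∫ y, (φ y : ℂ) * (g : Lp ℂ 2 γ) y ∂γ

/-- `g ∈ H_ℂ` is the gradient of `u` at `x` along `H`: for every `h ∈ H` the directional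
derivative `∂_h u(x)` exists and equals `[h, g]`. -/
def IsHGradientAt (γ : Measure X) (u : X → ℂ) (g : CameronMartinC γ) (x : X) : Prop :=
  ∀ φ ∈ reproducingSpace γ,
    HasDerivAt (fun t : ℝ => u (x + t • cmVector γ φ)) (pairing γ φ g) 0

/-! ### The Sobolev space `W^{1,2}(Ω, γ)` -/

/-- `L²(Ω, γ; ℂ)`. -/
abbrev L2 (γ : Measure X) (Ω : Set X) : Type _ := Lp ℂ 2 (γ.restrict Ω)

/-- `L²(Ω, γ; H_ℂ)`. -/
abbrev L2H (γ : Measure X) (Ω : Set X) : Type _ := Lp (CameronMartinC γ) 2 (γ.restrict Ω)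

/-- `L²(Ω, γ; ℂ) × L²(Ω, γ; H_ℂ)` with the Hilbert norm `(‖u‖² + ‖g‖²)^{1/2}`. -/
def L2Pair (γ : Measure X) (Ω : Set X) : Type _ := WithLp 2 (L2 γ Ω × L2H γ Ω)

instance (γ : Measure X) (Ω : Set X) : NormedAddCommGroup (L2Pair γ Ω) :=
  inferInstanceAs (NormedAddCommGroup (WithLp 2 (L2 γ Ω × L2H γ Ω)))

instance (γ : Measure X) (Ω : Set X) : InnerProductSpace ℂ (L2Pair γ Ω) :=
  inferInstanceAs (InnerProductSpace ℂ (WithLp 2 (L2 γ Ω × L2H γ Ω)))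

instance (γ : Measure X) (Ω : Set X) : CompleteSpace (L2Pair γ Ω) :=
  inferInstanceAs (CompleteSpace (WithLp 2 (L2 γ Ω × L2H γ Ω)))

/-- The first component `u` of a pair `(u, g)`. -/
def L2Pair.fn {γ : Measure X} {Ω : Set X} (w : L2Pair γ Ω) : L2 γ Ω := WithLp.fst w

/-- The second component `g` of a pair `(u, g)`. -/
def L2Pair.grad {γ : Measure X} {Ω : Set X} (w : L2Pair γ Ω) : L2H γ Ω := WithLp.snd w

theorem L2Pair.inner_eq {γ : Measure X} {Ω : Set X} (v w : L2Pair γ Ω) :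
    ⟪v, w⟫_ℂ = ⟪v.fn, w.fn⟫_ℂ + ⟪v.grad, w.grad⟫_ℂ :=
  WithLp.prod_inner_apply (𝕜 := ℂ) (E := L2 γ Ω) (F := L2H γ Ω) v w

theorem pairing_add (γ : Measure X) (φ : Lp ℝ 2 γ) (g k : CameronMartinC γ) :
    pairing γ φ (g + k) = pairing γ φ g + pairing γ φ k := by
  unfold pairing
  rw [← integral_add (pairing_integrable γ φ g) (pairing_integrable γ φ k)]
  refine integral_congr_ae ?_
  filter_upwards [Lp.coeFn_add (g : Lp ℂ 2 γ) (k : Lp ℂ 2 γ)] with y hy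
  rw [Submodule.coe_add, hy, Pi.add_apply, mul_add]

theorem pairing_smul (γ : Measure X) (φ : Lp ℝ 2 γ) (c : ℂ) (g : CameronMartinC γ) :
    pairing γ φ (c • g) = c * pairing γ φ g := by
  unfold pairing
  rw [← integral_const_mul]
  refine integral_congr_ae ?_
  filter_upwards [Lp.coeFn_smul c (g : Lp ℂ 2 γ)] with y hy
  rw [Submodule.coe_smul, hy, Pi.smul_apply, smul_eq_mul]
  ring

theorem pairing_zero (γ : Measure X) (φ : Lp ℝ 2 γ) : pairing γ φ 0 = 0 := by
  simpa using pairing_smul γ φ 0 0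

/-- The graph of `ũ|_Ω ↦ (∇_H ũ)|_Ω`, where `ũ` runs through the Lipschitz functions on `X`.
The gradient `∇_H ũ` of a Lipschitz function exists `γ`-almost everywhere on `X`. -/
def lipschitzGraph (γ : Measure X) (Ω : Set X) : Submodule ℂ (L2Pair γ Ω) where
  carrier := {w | ∃ (u : X → ℂ) (G : X → CameronMartinC γ),
    (∃ K : ℝ≥0, LipschitzWith K u) ∧ AEStronglyMeasurable G γ ∧
    (∀ᵐ x ∂γ, IsHGradientAt γ u (G x) x) ∧
    w.fn =ᵐ[γ.restrict Ω] u ∧ w.grad =ᵐ[γ.restrict Ω] G}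
  zero_mem' := by
    refine ⟨0, 0, ⟨0, LipschitzWith.const 0⟩, aestronglyMeasurable_zero, ?_,
      Lp.coeFn_zero _ _ _, Lp.coeFn_zero _ _ _⟩
    refine Eventually.of_forall fun x φ _ => ?_
    simpa [pairing_zero] using hasDerivAt_const (0 : ℝ) (0 : ℂ)
  add_mem' := by
    rintro w z ⟨u, G, ⟨K, hK⟩, hG, hd, h1, h2⟩ ⟨v, M, ⟨K', hK'⟩, hM, hd', h1', h2'⟩
    refine ⟨u + v, G + M, ⟨K + K', hK.add hK'⟩, hG.add hM, ?_, ?_, ?_⟩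
    · filter_upwards [hd, hd'] with x hx hx' φ hφ
      rw [Pi.add_apply, pairing_add]
      exact (hx φ hφ).add (hx' φ hφ)
    · exact (Lp.coeFn_add w.fn z.fn).trans (h1.add h1')
    · exact (Lp.coeFn_add w.grad z.grad).trans (h2.add h2')
  smul_mem' := by
    rintro c w ⟨u, G, ⟨K, hK⟩, hG, hd, h1, h2⟩
    refine ⟨c • u, c • G, ⟨‖c‖₊ * K, (lipschitzWith_smul c).comp hK⟩, hG.const_smul c, ?_, ?_, ?_⟩
    · filter_upwards [hd] with x hx φ hφ
      rw [Pi.smul_apply, pairing_smul]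
      exact (hx φ hφ).const_mul c
    · exact (Lp.coeFn_smul c w.fn).trans (h1.const_smul c)
    · exact (Lp.coeFn_smul c w.grad).trans (h2.const_smul c)

/-- `W^{1,2}(Ω, γ; ℂ)`, as the graph of the closure of `ũ|_Ω ↦ (∇_H ũ)|_Ω`: an element `w` is the
pair of the Sobolev function `w.fn` and its gradient `w.grad = ∇_H w.fn`. Its norm is the norm
`(∫_Ω |u|² dγ + ∫_Ω |∇_H u|² dγ)^{1/2}` of `W^{1,2}(Ω, γ)`. -/
def W12 (γ : Measure X) (Ω : Set X) : Submodule ℂ (L2Pair γ Ω) :=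
  (lipschitzGraph γ Ω).topologicalClosure

instance (γ : Measure X) (Ω : Set X) : CompleteSpace (W12 γ Ω) :=
  Submodule.topologicalClosure.completeSpace _

/-- The functions `u n` and `v` belong to `W^{1,2}(Ω, γ)` and `u n → v` in the norm of
`W^{1,2}(Ω, γ)`. -/
def TendstoW12 (γ : Measure X) (Ω : Set X) (u : ℕ → L2 γ Ω) (v : L2 γ Ω) : Prop :=
  ∃ (w : ℕ → W12 γ Ω) (z : W12 γ Ω),
    (∀ n, (w n : L2Pair γ Ω).fn = u n) ∧ (z : L2Pair γ Ω).fn = v ∧ Tendsto w atTop (𝓝 z)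

/-! ### The Ornstein-Uhlenbeck operator -/

/-- The sesquilinear Dirichlet form `∫_Ω [∇_H u, conj (∇_H v)] dγ`. Mathlib's inner product is
conjugate linear in its first argument. -/
def dirichletForm (γ : Measure X) (Ω : Set X) (u v : W12 γ Ω) : ℂ :=
  ⟪(v : L2Pair γ Ω).grad, (u : L2Pair γ Ω).grad⟫_ℂ

/-- The graph of the Ornstein-Uhlenbeck operator `L` of `Ω`: `u ∈ D(L)` and `L u = f` when
`u ∈ W^{1,2}(Ω, γ)` and the Dirichlet form satisfies `E(u, v) = - ∫_Ω f conj(v) dγ` for all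
`v ∈ W^{1,2}(Ω, γ)`. -/
def ouGraph (γ : Measure X) (Ω : Set X) : Set (L2 γ Ω × L2 γ Ω) :=
  {p | ∃ u : W12 γ Ω, (u : L2Pair γ Ω).fn = p.1 ∧
    ∀ v : W12 γ Ω, dirichletForm γ Ω u v = -⟪(v : L2Pair γ Ω).fn, p.2⟫_ℂ}

end Sobolev

/-! ### Resolvents and semigroups of an operator given by its graph -/

section Operators

variable {E : Type*} [NormedAddCommGroup E] [NormedSpace ℂ E]

/-- `z` is in the resolvent set of the operator `A` with graph `A`, and `R` is the bounded operator
`R(z, A) = (z - A)⁻¹`: for every `f`, the only `u ∈ D(A)` with `z u - A u = f` is `u = R f`. -/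
def IsResolvent (A : Set (E × E)) (z : ℂ) (R : E →L[ℂ] E) : Prop :=
  ∀ f u : E, (u, z • u - f) ∈ A ↔ u = R f

/-- `T` is the strongly continuous semigroup whose infinitesimal generator is the operator with
graph `A`. (A strongly continuous semigroup is determined by its generator.) -/
structure IsSemigroupGeneratedBy (A : Set (E × E)) (T : ℝ≥0 → E →L[ℂ] E) : Prop where
  zero : T 0 = ContinuousLinearMap.id ℂ E
  add : ∀ s t, T (s + t) = (T s).comp (T t)
  continuous : ∀ u, Continuous fun t => T t u
  generator : ∀ u f, (u, f) ∈ A ↔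
    Tendsto (fun t : ℝ≥0 => (t : ℝ)⁻¹ • (T t u - u)) (𝓝[>] 0) (𝓝 f)

end Operators

/-! ### Smooth convex cylinders -/

/-- The boundary of the open set `O` is smooth: near each of its boundary points, `O` is the
sublevel set `{ρ < 0}` of a smooth function `ρ` with nonvanishing differential. -/
def HasSmoothBoundary {F : Type*} [NormedAddCommGroup F] [NormedSpace ℝ F] (O : Set F) : Prop :=
  ∀ p ∈ frontier O, ∃ (V : Set F) (ρ : F → ℝ), IsOpen V ∧ p ∈ V ∧ ContDiffOn ℝ ∞ ρ V ∧
    (∀ q ∈ V, fderiv ℝ ρ q ≠ 0) ∧ V ∩ O = {q ∈ V | ρ q < 0}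

/-- `U = P⁻¹(O)` for a continuous linear projection `P` of `X` onto a finite dimensional
subspace `F` and an open convex set `O ⊆ F` with smooth boundary. -/
def IsSmoothConvexCylinder {X : Type*} [NormedAddCommGroup X] [NormedSpace ℝ X]
    (U : Set X) : Prop :=
  ∃ (F : Submodule ℝ X) (P : X →L[ℝ] F) (O : Set F), FiniteDimensional ℝ F ∧
    (∀ y : F, P y = y) ∧ IsOpen O ∧ Convex ℝ O ∧ HasSmoothBoundary O ∧ U = P ⁻¹' O

end WienerOU

end

/-! Let `ι` be the embedding of `W^{1,2}(Ω)` into `L²(Ω)`, a contraction with dense range. Adding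
`⟪v, u⟫` to both sides of the weak equation turns `L u = f` into `u = ι ι* (u - f)` (`ouGraph_eq`).
Thus `R = ι ι*` is the resolvent of `L` at `1`. It is a positive contraction, so its spectrum lies
in `[0, 1]`, and `L = 1 - R⁻¹`.

The continuous functional calculus of `R` then gives `R(z, L)` for `z` off `(-∞, 0]`, and `exp (t
L)` for `t > 0`. Both have the form `R k(R) = ι (ι* k(R))` with `k` continuous on `[0, 1]`, so the
function `ι* k(R) f` of `W^{1,2}` represents the result. Both claims thus reduce to one: `ιn* k(Rn)
f`, restricted to `Ω`, converges to `ι* k(R) f` in `W^{1,2}(Ω)`.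

By Weierstrass approximation, uniform in `n`, it is enough to treat powers of `Rn`, and so to prove
convergence of `ιn*` (`discreteTendsto_adjoint_image`). Restriction commutes with the embeddings.
Taking adjoints and using that the measure of `Ωn \ Ω` tends to `0`, one compares `ιn* f` with the
restriction to `Ωn` of a function in `W^{1,2}(X)` whose restriction to `Ω` is close to `ι* f`. Such
functions exist because Lipschitz functions on `X` have bounded gradients along `H`, hence lie in
`W^{1,2}(X)` (`denseRange_restrict_univ`). The range of `ι` is dense because characters determine
finite measures (`denseRange_embed`). -/

namespace WienerOU

/-! ### Functional calculus of a positive contraction. -/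

section UnitCalculus

variable {E : Type*} [NormedAddCommGroup E] [InnerProductSpace ℂ E] [CompleteSpace E]
  {R : E →L[ℂ] E}

/-- The function `k` of a positive contraction `R`, for `k` continuous on `[0, 1]`. -/
noncomputable def unitCalc (R : E →L[ℂ] E) (k : ℝ → ℂ) : E →L[ℂ] E := cfc (fun z : ℂ => k z.re) R

open scoped ComplexOrder in
theorem re_mem_Icc_of_mem_spectrum (hR : R.IsPositive) (hR1 : ‖R‖ ≤ 1) {z : ℂ}
    (hz : z ∈ spectrum ℂ R) : z.re ∈ Set.Icc (0 : ℝ) 1 ∧ (z.re : ℂ) = z := by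
  have him : z.im = 0 := hR.isSelfAdjoint.im_eq_zero_of_mem_spectrum hz
  -- The bound of the spectrum by the norm needs `‖1‖ = 1`. On the zero space the spectrum is empty.
  have hE : Nontrivial E := by
    by_contra h
    rw [not_nontrivial_iff_subsingleton] at h
    have : Subsingleton (E →L[ℂ] E) := ⟨fun a b => by ext x; exact Subsingleton.elim _ _⟩
    rw [spectrum.of_subsingleton] at hz
    exact hz
  have h0 : 0 ≤ z :=
    spectrum_nonneg_of_nonneg ((ContinuousLinearMap.nonneg_iff_isPositive R).2 hR) hz
  refine ⟨⟨(Complex.le_def.1 h0).1, ?_⟩, Complex.ext rfl (by simp [him])⟩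
  exact (Complex.re_le_norm z).trans ((spectrum.norm_le_norm_of_mem hz).trans hR1)

theorem continuousOn_comp_re (hR : R.IsPositive) (hR1 : ‖R‖ ≤ 1) {k : ℝ → ℂ}
    (hk : ContinuousOn k (Set.Icc 0 1)) :
    ContinuousOn (fun z : ℂ => k z.re) (spectrum ℂ R) :=
  hk.comp Complex.continuous_re.continuousOn fun _ hz => (re_mem_Icc_of_mem_spectrum hR hR1 hz).1

theorem unitCalc_mul (hR : R.IsPositive) (hR1 : ‖R‖ ≤ 1) {k l : ℝ → ℂ}
    (hk : ContinuousOn k (Set.Icc 0 1)) (hl : ContinuousOn l (Set.Icc 0 1)) :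
    unitCalc R (fun r => k r * l r) = unitCalc R k * unitCalc R l :=
  cfc_mul _ _ R (continuousOn_comp_re hR hR1 hk) (continuousOn_comp_re hR hR1 hl)

theorem unitCalc_sub (hR : R.IsPositive) (hR1 : ‖R‖ ≤ 1) {k l : ℝ → ℂ}
    (hk : ContinuousOn k (Set.Icc 0 1)) (hl : ContinuousOn l (Set.Icc 0 1)) :
    unitCalc R (fun r => k r - l r) = unitCalc R k - unitCalc R l :=
  cfc_sub _ _ R (continuousOn_comp_re hR hR1 hk) (continuousOn_comp_re hR hR1 hl)

theorem unitCalc_congr (hR : R.IsPositive) (hR1 : ‖R‖ ≤ 1) {k l : ℝ → ℂ}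
    (h : Set.EqOn k l (Set.Icc 0 1)) : unitCalc R k = unitCalc R l :=
  cfc_congr fun _ hz => h (re_mem_Icc_of_mem_spectrum hR hR1 hz).1

theorem norm_unitCalc_le (hR : R.IsPositive) (hR1 : ‖R‖ ≤ 1) {k : ℝ → ℂ} {c : ℝ} (hc : 0 ≤ c)
    (h : ∀ r ∈ Set.Icc (0 : ℝ) 1, ‖k r‖ ≤ c) : ‖unitCalc R k‖ ≤ c :=
  norm_cfc_le hc fun _ hz => h _ (re_mem_Icc_of_mem_spectrum hR hR1 hz).1

theorem unitCalc_polynomial (hR : R.IsPositive) (hR1 : ‖R‖ ≤ 1) (p : Polynomial ℂ) :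
    unitCalc R (fun r => p.eval (r : ℂ)) = Polynomial.aeval R p := by
  have := hR.isSelfAdjoint.isStarNormal
  rw [← cfc_polynomial p R]
  exact cfc_congr fun z hz => by simp only [(re_mem_Icc_of_mem_spectrum hR hR1 hz).2]

theorem unitCalc_one (hR : R.IsPositive) (hR1 : ‖R‖ ≤ 1) : unitCalc R (fun _ => 1) = 1 := by
  simpa using unitCalc_polynomial hR hR1 1

theorem unitCalc_id (hR : R.IsPositive) (hR1 : ‖R‖ ≤ 1) :
    unitCalc R (fun r => (r : ℂ)) = R := by
  simpa using unitCalc_polynomial hR hR1 Polynomial.X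

theorem unitCalc_mul_id (hR : R.IsPositive) (hR1 : ‖R‖ ≤ 1) {k : ℝ → ℂ}
    (hk : ContinuousOn k (Set.Icc 0 1)) : unitCalc R (fun r => k r * r) = unitCalc R k * R := by
  rw [unitCalc_mul hR hR1 hk (by fun_prop), unitCalc_id hR hR1]

theorem self_mul_unitCalc (hR : R.IsPositive) (hR1 : ‖R‖ ≤ 1) {k : ℝ → ℂ}
    (hk : ContinuousOn k (Set.Icc 0 1)) : R * unitCalc R k = unitCalc R k * R := by
  rw [← unitCalc_mul_id hR hR1 hk]
  simp_rw [mul_comm (k _)]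
  rw [unitCalc_mul hR hR1 (by fun_prop) hk, unitCalc_id hR hR1]

/-- Weierstrass approximation by complex polynomials on `[0, 1]`. -/
theorem exists_complex_polynomial_near {k : ℝ → ℂ} (hk : ContinuousOn k (Set.Icc 0 1)) {ε : ℝ}
    (hε : 0 < ε) : ∃ p : Polynomial ℂ, ∀ r ∈ Set.Icc (0 : ℝ) 1, ‖k r - p.eval (r : ℂ)‖ ≤ ε := by
  obtain ⟨p, hp⟩ := exists_polynomial_near_of_continuousOn 0 1 (fun r => (k r).re)
    (Complex.continuous_re.comp_continuousOn hk) (ε / 2) (by positivity)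
  obtain ⟨q, hq⟩ := exists_polynomial_near_of_continuousOn 0 1 (fun r => (k r).im)
    (Complex.continuous_im.comp_continuousOn hk) (ε / 2) (by positivity)
  refine ⟨p.map (algebraMap ℝ ℂ) + Polynomial.C Complex.I * q.map (algebraMap ℝ ℂ),
    fun r hr => ?_⟩
  have e1 : (p.map (algebraMap ℝ ℂ)).eval (r : ℂ) = (p.eval r : ℝ) :=
    Polynomial.eval_map_algebraMap p (r : ℂ) |>.trans (Polynomial.aeval_algebraMap_apply ℂ r p)
  have e2 : (q.map (algebraMap ℝ ℂ)).eval (r : ℂ) = (q.eval r : ℝ) :=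
    Polynomial.eval_map_algebraMap q (r : ℂ) |>.trans (Polynomial.aeval_algebraMap_apply ℂ r q)
  rw [Polynomial.eval_add, Polynomial.eval_mul, Polynomial.eval_C, e1, e2]
  refine (Complex.norm_le_abs_re_add_abs_im _).trans ?_
  have h1 := hp r hr
  have h2 := hq r hr
  rw [abs_sub_comm] at h1 h2
  simpa using (add_le_add h1.le h2.le).trans (by linarith)

end UnitCalculus

/-! ### Resolvents of `1 - R⁻¹` as functions of `R`. -/

section Resolvent

variable {E : Type*} [NormedAddCommGroup E] [InnerProductSpace ℂ E] [CompleteSpace E]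
  {R : E →L[ℂ] E}

/-- The graph of `A = 1 - R⁻¹`, i.e. of the operator `A` with `R(1, A) = R`. -/
def graphOfResolvent (R : E →L[ℂ] E) : Set (E × E) := {p | p.1 = R (p.1 - p.2)}

/-- `z - 1 + 1 / r` is `1 / r` times the inverse of this function. -/
noncomputable def resolventFactor (z : ℂ) (r : ℝ) : ℂ := (1 + (z - 1) * r)⁻¹

/-- For `r > 0` a zero would force `z = 1 - 1 / r ≤ 0`; at `r = 0` the value is `1`. -/
theorem one_add_mul_ne_zero {z : ℂ} (hz : z ∈ Complex.slitPlane) {r : ℝ}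
    (hr : r ∈ Set.Icc (0 : ℝ) 1) : 1 + (z - 1) * (r : ℂ) ≠ 0 := by
  intro h
  have hre := congrArg Complex.re h
  have him := congrArg Complex.im h
  simp at hre him
  rcases hz with hz | hz
  · nlinarith [hr.1, hr.2, mul_nonneg hr.1 hz.le]
  · rcases him with him | him
    · exact hz him
    · simp [him] at hre

theorem continuousOn_resolventFactor {z : ℂ} (hz : z ∈ Complex.slitPlane) :
    ContinuousOn (resolventFactor z) (Set.Icc 0 1) :=
  ContinuousOn.inv₀ (by fun_prop) fun _ hr => one_add_mul_ne_zero hz hr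

/-- Formally `z - (1 - R⁻¹) = R⁻¹ (1 + (z - 1) R)`, and the second factor is inverted by the
functional calculus. `R` itself is never inverted: the equation is multiplied by `R` first. -/
theorem isResolvent_graphOfResolvent (hR : R.IsPositive) (hR1 : ‖R‖ ≤ 1) {z : ℂ}
    (hz : z ∈ Complex.slitPlane) :
    IsResolvent (graphOfResolvent R) z (R * unitCalc R (resolventFactor z)) := by
  set B := unitCalc R (resolventFactor z) with hB
  have hcomm : R * B = B * R :=
    self_mul_unitCalc hR hR1 (continuousOn_resolventFactor hz)
  have hinv : B * (1 + (z - 1) • R) = 1 := by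
    have h := unitCalc_polynomial hR hR1 (1 + Polynomial.C (z - 1) * Polynomial.X)
    simp only [map_add, map_one, map_mul, Polynomial.aeval_C, Polynomial.aeval_X,
      ← Algebra.smul_def, Polynomial.eval_add, Polynomial.eval_one, Polynomial.eval_mul,
      Polynomial.eval_C, Polynomial.eval_X] at h
    rw [← h, hB, ← unitCalc_mul hR hR1 (continuousOn_resolventFactor hz) (by fun_prop),
      ← unitCalc_one hR hR1]
    exact unitCalc_congr hR hR1 fun r hr => inv_mul_cancel₀ (one_add_mul_ne_zero hz hr)
  have hinv' : ∀ x, B x + (z - 1) • R (B x) = x := fun x => by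
    have h := DFunLike.congr_fun hinv x
    have hc := DFunLike.congr_fun hcomm x
    simp only [mul_add, mul_one, mul_smul_comm] at h
    rw [← hcomm] at h
    simpa using h
  intro f u
  change u = R (u - (z • u - f)) ↔ u = R (B f)
  constructor
  · intro h
    have hu : u + (z - 1) • R u = R f := by
      have : R (u - (z • u - f)) = R f - (z - 1) • R u := by
        simp only [map_sub, map_smul]; module
      rw [this] at h
      exact eq_sub_iff_add_eq.1 h
    have := DFunLike.congr_fun hinv u
    change B (u + (z - 1) • R u) = u at this
    rw [hu] at this
    rw [← this]
    exact (DFunLike.congr_fun hcomm f).symm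
  · intro h
    have : u - (z • u - f) = B f := by
      conv_lhs => rw [h]
      nth_rewrite 3 [← hinv' f]
      module
    rw [this, ← h]

end Resolvent

/-! ### Scalar estimates for `exp (t (1 - 1 / r))` on `[0, 1]`. -/

section HeatFactor

/-- The value at `r` of the function with which the resolvent `R(1, A) = r` gives `exp (t A)`. -/
noncomputable def heatFactor (t r : ℝ) : ℝ :=
  if t = 0 then 1 else if r ≤ 0 then 0 else Real.exp (t - t / r)

/-- The quotient of `heatFactor t r` by `r`. -/
noncomputable def heatQuotient (t r : ℝ) : ℝ := if r ≤ 0 then 0 else Real.exp (t - t / r) / r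

theorem sub_div_nonpos {t r : ℝ} (ht : 0 ≤ t) (hr : 0 < r) (hr1 : r ≤ 1) : t - t / r ≤ 0 := by
  have : t ≤ t / r := by rw [le_div_iff₀ hr]; nlinarith
  linarith

theorem heatFactor_nonneg (t r : ℝ) : 0 ≤ heatFactor t r := by
  unfold heatFactor; split_ifs <;> positivity

theorem heatFactor_le_one {t r : ℝ} (ht : 0 ≤ t) (hr1 : r ≤ 1) : heatFactor t r ≤ 1 := by
  unfold heatFactor
  split_ifs with h h'
  · exact le_rfl
  · exact zero_le_one
  · exact Real.exp_le_one_iff.2 (sub_div_nonpos ht (not_le.1 h') hr1)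

/-- The separate case `t = 0` in the definition makes this true at `r = 0` as well, so that the
semigroup starts at the identity. -/
theorem heatFactor_zero (r : ℝ) : heatFactor 0 r = 1 := if_pos rfl

theorem heatFactor_of_pos (t : ℝ) {r : ℝ} (hr : 0 < r) :
    heatFactor t r = Real.exp (t - t / r) := by
  unfold heatFactor
  split_ifs with h h'
  · simp [h]
  · exact absurd hr (not_lt.2 h')
  · rfl

theorem heatFactor_eq_mul {t r : ℝ} (ht : t ≠ 0) : heatFactor t r = r * heatQuotient t r := by
  unfold heatFactor heatQuotient
  rw [if_neg ht]
  split_ifs with h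
  · simp
  · rw [mul_div_cancel₀ _ (not_le.1 h).ne']

theorem heatFactor_add {s t : ℝ} (hs : 0 ≤ s) (ht : 0 ≤ t) (r : ℝ) :
    heatFactor (s + t) r = heatFactor s r * heatFactor t r := by
  rcases hs.eq_or_lt with rfl | hs
  · simp [heatFactor_zero]
  rcases ht.eq_or_lt with rfl | ht
  · simp [heatFactor_zero]
  unfold heatFactor
  rw [if_neg (by positivity), if_neg hs.ne', if_neg ht.ne']
  split_ifs
  · simp
  · rw [← Real.exp_add]; ring_nf

/-- At `r = 0` the exponential beats `1 / r`: from `exp x ≥ x² / 2` with `x = t / r` the quotient is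
at most `2 exp(t) r / t²`. -/
theorem continuousOn_heatQuotient {t : ℝ} (ht : 0 < t) :
    ContinuousOn (heatQuotient t) (Set.Icc 0 1) := by
  intro r hr
  rcases hr.1.eq_or_lt with rfl | hr0
  · have h0 : heatQuotient t 0 = 0 := by simp [heatQuotient]
    rw [ContinuousWithinAt, h0]
    refine squeeze_zero_norm' (a := fun r => Real.exp t * 2 / t ^ 2 * r) ?_ ?_
    · filter_upwards [self_mem_nhdsWithin] with r hr
      unfold heatQuotient
      split_ifs with h
      · simpa using mul_nonneg (by positivity) hr.1
      · have hr0 := not_le.1 h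
        rw [Real.norm_of_nonneg (by positivity), Real.exp_sub, div_div, div_mul_eq_mul_div,
          div_le_div_iff₀ (by positivity) (by positivity)]
        have hq := Real.quadratic_le_exp_of_nonneg (x := t / r) (by positivity)
        have hq' : (t / r) ^ 2 / 2 ≤ Real.exp (t / r) := by
          have : 0 ≤ t / r := by positivity
          linarith
        have e : t ^ 2 = (t / r) ^ 2 / 2 * (2 * r * r) := by field_simp
        calc Real.exp t * t ^ 2 = Real.exp t * ((t / r) ^ 2 / 2 * (2 * r * r)) := by rw [← e]
          _ ≤ Real.exp t * (Real.exp (t / r) * (2 * r * r)) := by gcongr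
          _ = _ := by ring
    · have : Continuous fun r : ℝ => Real.exp t * 2 / t ^ 2 * r := by fun_prop
      simpa using (this.tendsto 0).mono_left nhdsWithin_le_nhds
  · refine ContinuousAt.continuousWithinAt ?_
    have : ContinuousAt (fun r => Real.exp (t - t / r) / r) r := by
      have := hr0.ne'
      fun_prop (disch := assumption)
    refine this.congr ?_
    filter_upwards [lt_mem_nhds hr0] with x hx
    rw [heatQuotient, if_neg (not_le.2 hx)]

theorem continuousOn_heatFactor {t : ℝ} (ht : 0 ≤ t) :
    ContinuousOn (heatFactor t) (Set.Icc 0 1) := by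
  rcases ht.eq_or_lt with rfl | ht
  · exact continuousOn_const.congr fun r _ => heatFactor_zero r
  · exact (continuousOn_id.mul (continuousOn_heatQuotient ht)).congr
      fun r _ => heatFactor_eq_mul ht.ne'

/-- Continuity in `t` is not uniform near `r = 0`; the factor `r`, that is, restriction to the range
of `R`, repairs this. The semigroup law reduces to `1 - exp (-x) ≤ x` with `x = (t - s) (1 / r -
1)`, and `r x ≤ t - s`. -/
theorem abs_heatFactor_sub_mul_le {s t r : ℝ} (hs : 0 ≤ s) (ht : 0 ≤ t)
    (hr : r ∈ Set.Icc (0 : ℝ) 1) : |(heatFactor t r - heatFactor s r) * r| ≤ |t - s| := by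
  wlog hst : s ≤ t generalizing s t
  · have := this ht hs (le_of_not_ge hst)
    rwa [abs_sub_comm t s, ← abs_neg, ← neg_mul, neg_sub]
  rcases hr.1.eq_or_lt with rfl | hr0
  · simp
  have h1 : heatFactor t r = heatFactor (t - s) r * heatFactor s r := by
    rw [← heatFactor_add (by linarith) hs]; ring_nf
  have h2 : (heatFactor t r - heatFactor s r) * r
      = -(heatFactor s r * ((1 - heatFactor (t - s) r) * r)) := by rw [h1]; ring
  have h3 : heatFactor (t - s) r ≤ 1 := heatFactor_le_one (by linarith) hr.2
  have h4 : (1 - heatFactor (t - s) r) * r ≤ t - s := by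
    rw [heatFactor_of_pos _ hr0]
    have := Real.add_one_le_exp (t - s - (t - s) / r)
    calc _ ≤ ((t - s) / r - (t - s)) * r := mul_le_mul_of_nonneg_right (by linarith) hr.1
      _ = (t - s) * (1 - r) := by field_simp
      _ ≤ _ := by nlinarith [hr.2]
  have h5 : 0 ≤ (1 - heatFactor (t - s) r) * r := mul_nonneg (by linarith) hr.1
  have h6 := heatFactor_nonneg s r
  have h7 := heatFactor_le_one hs hr.2
  rw [h2, abs_neg, abs_of_nonneg (mul_nonneg h6 h5), abs_of_nonneg (by linarith)]
  calc _ ≤ 1 * ((1 - heatFactor (t - s) r) * r) := by gcongr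
    _ ≤ _ := by linarith

theorem exp_neg_sub_one_add_le {x : ℝ} (hx : 0 ≤ x) :
    |Real.exp (-x) - 1 + x| ≤ x ^ 2 := by
  have h1 := Real.add_one_le_exp (-x)
  rw [abs_of_nonneg (by linarith), Real.exp_neg]
  have h2 := Real.add_one_le_exp x
  have h3 : (Real.exp x)⁻¹ ≤ (x + 1)⁻¹ := by gcongr
  have h4 : (x + 1)⁻¹ - 1 + x = x ^ 2 / (x + 1) := by field_simp; ring
  have h5 : x ^ 2 / (x + 1) ≤ x ^ 2 := div_le_self (by positivity) (by linarith)
  linarith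

/-- The generator has symbol `1 - 1 / r`. With `x = t (1 / r - 1)` the quadratic Taylor remainder
costs `x² / t`, and two factors `r` turn it into `t (1 - r)²`. -/
theorem abs_heatFactor_slope_le {t r : ℝ} (ht : 0 < t) (hr : r ∈ Set.Icc (0 : ℝ) 1) :
    |t⁻¹ * (heatFactor t r - 1) * r * r - (r - 1) * r| ≤ t := by
  rcases hr.1.eq_or_lt with rfl | hr0
  · simpa using ht.le
  set x := t / r - t with hx
  have hx0 : 0 ≤ x := by linarith [sub_div_nonpos ht.le hr0 hr.2]
  have e : t⁻¹ * (heatFactor t r - 1) * r * r - (r - 1) * r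
      = t⁻¹ * r ^ 2 * (Real.exp (-x) - 1 + x) := by
    rw [heatFactor_of_pos _ hr0, show t - t / r = -x by ring]
    have : x * r = t * (1 - r) := by rw [hx]; field_simp
    field_simp
    linear_combination -this
  rw [e, abs_mul, abs_of_nonneg (by positivity)]
  calc _ ≤ t⁻¹ * r ^ 2 * x ^ 2 := by gcongr; exact exp_neg_sub_one_add_le hx0
    _ = t * (1 - r) ^ 2 := by rw [hx]; field_simp
    _ ≤ t * 1 := by
      gcongr
      exact pow_le_one₀ (by linarith [hr.2]) (by linarith [hr.1])
    _ = t := mul_one t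

end HeatFactor

/-! ### Strong convergence from a dense set. -/

section StrongConvergence

variable {ι E F G : Type*} [NormedAddCommGroup E] [NormedSpace ℂ E] [NormedAddCommGroup F]
  [NormedSpace ℂ F]

/-- Strong convergence of a bounded net of operators follows from convergence on a dense set. -/
theorem tendsto_apply_of_denseRange {l : Filter ι} {S : ι → E →L[ℂ] F} {S₀ : E →L[ℂ] F} {C : ℝ}
    {φ : G → E} (hφ : DenseRange φ) (hS : ∀ᶠ i in l, ‖S i‖ ≤ C)
    (h : ∀ v, Tendsto (fun i => S i (φ v)) l (𝓝 (S₀ (φ v)))) (u : E) :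
    Tendsto (fun i => S i u) l (𝓝 (S₀ u)) := by
  rw [Metric.tendsto_nhds]
  intro ε hε
  -- The absolute value covers a possibly negative `C` (when the filter is trivial); the `1` keeps
  -- `K` positive.
  set K := |C| + ‖S₀‖ + 1 with hK
  have hK0 : 0 < K := by positivity
  obtain ⟨v, hv⟩ := hφ.exists_dist_lt u (show 0 < ε / (2 * K) by positivity)
  filter_upwards [hS, Metric.tendsto_nhds.1 (h v) (ε / 2) (by positivity)] with i hi hiv
  rw [dist_eq_norm] at hv hiv ⊢
  have e : S i u - S₀ u = S i (u - φ v) + (S i (φ v) - S₀ (φ v)) - S₀ (u - φ v) := by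
    simp only [map_sub]; abel
  rw [e]
  calc _ ≤ ‖S i (u - φ v)‖ + ‖S i (φ v) - S₀ (φ v)‖ + ‖S₀ (u - φ v)‖ :=
        (norm_sub_le _ _).trans (add_le_add_left (norm_add_le _ _) _)
    _ ≤ |C| * ‖u - φ v‖ + ‖S i (φ v) - S₀ (φ v)‖ + ‖S₀‖ * ‖u - φ v‖ := by
        gcongr
        · exact (S i).le_of_opNorm_le (hi.trans (le_abs_self C)) _
        · exact S₀.le_opNorm _
    _ = (|C| + ‖S₀‖) * ‖u - φ v‖ + ‖S i (φ v) - S₀ (φ v)‖ := by ring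
    _ < K * (ε / (2 * K)) + ε / 2 := by
        refine add_lt_add_of_le_of_lt ?_ hiv
        gcongr
        linarith
    _ = ε := by field_simp; ring

end StrongConvergence

/-! ### The semigroup generated by `1 - R⁻¹`. -/

section Semigroup

variable {E : Type*} [NormedAddCommGroup E] [InnerProductSpace ℂ E] [CompleteSpace E]
  {R : E →L[ℂ] E}

/-- The semigroup `exp (t (1 - R⁻¹))`. -/
noncomputable def heatSemigroup (R : E →L[ℂ] E) (t : ℝ≥0) : E →L[ℂ] E :=
  unitCalc R fun r => heatFactor t r

theorem continuousOn_ofReal_heatFactor (t : ℝ≥0) :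
    ContinuousOn (fun r => (heatFactor t r : ℂ)) (Set.Icc 0 1) :=
  Complex.continuous_ofReal.comp_continuousOn (continuousOn_heatFactor t.2)

theorem norm_heatSemigroup_le (hR : R.IsPositive) (hR1 : ‖R‖ ≤ 1) (t : ℝ≥0) :
    ‖heatSemigroup R t‖ ≤ 1 :=
  norm_unitCalc_le hR hR1 zero_le_one fun r hr => by
    rw [Complex.norm_real, Real.norm_of_nonneg (heatFactor_nonneg _ _)]
    exact heatFactor_le_one t.2 hr.2

/-- The smoothing effect: for `t > 0` a factor `R` splits off, which puts the semigroup in the same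
form as the resolvents. -/
theorem heatSemigroup_eq (hR : R.IsPositive) (hR1 : ‖R‖ ≤ 1) {t : ℝ≥0} (ht : 0 < t) :
    heatSemigroup R t = R * unitCalc R fun r => heatQuotient t r := by
  have hq : ContinuousOn (fun r => (heatQuotient t r : ℂ)) (Set.Icc 0 1) :=
    Complex.continuous_ofReal.comp_continuousOn (continuousOn_heatQuotient ht)
  rw [self_mul_unitCalc hR hR1 hq, ← unitCalc_mul_id hR hR1 hq, heatSemigroup]
  refine congrArg _ (funext fun r => ?_)
  rw [heatFactor_eq_mul (NNReal.coe_pos.2 ht).ne']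
  push_cast
  ring

/-- On the range of `R` the orbits are Lipschitz in `t`; density and contractivity give the rest. -/
theorem continuous_heatSemigroup_apply (hR : R.IsPositive) (hR1 : ‖R‖ ≤ 1) (hd : DenseRange R)
    (u : E) : Continuous fun t => heatSemigroup R t u := by
  rw [continuous_iff_continuousAt]
  intro t
  refine tendsto_apply_of_denseRange hd (.of_forall (norm_heatSemigroup_le hR hR1)) (fun v => ?_) u
  rw [tendsto_iff_norm_sub_tendsto_zero]
  refine squeeze_zero (fun _ => norm_nonneg _) (g := fun s : ℝ≥0 => |(s : ℝ) - t| * ‖v‖)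
    (fun s => ?_) ?_
  · change ‖(heatSemigroup R s * R) v - (heatSemigroup R t * R) v‖ ≤ _
    rw [← sub_apply]
    refine ContinuousLinearMap.le_of_opNorm_le _ ?_ _
    rw [← sub_mul, heatSemigroup, heatSemigroup,
      ← unitCalc_sub hR hR1 (continuousOn_ofReal_heatFactor s) (continuousOn_ofReal_heatFactor t),
      ← unitCalc_mul_id hR hR1 (ContinuousOn.fun_sub
        (continuousOn_ofReal_heatFactor s) (continuousOn_ofReal_heatFactor t))]
    refine norm_unitCalc_le hR hR1 (abs_nonneg _) fun r hr => ?_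
    have := abs_heatFactor_sub_mul_le t.2 s.2 hr
    rwa [← Real.norm_eq_abs, ← Complex.norm_real, Complex.ofReal_mul, Complex.ofReal_sub] at this
  · have : Continuous fun s : ℝ≥0 => |(s : ℝ) - t| * ‖v‖ := by fun_prop
    simpa using this.tendsto t

/-- The difference quotients composed with `R` have norm at most `1`, and on the range of `R` they
converge at rate `t`. Density of that range gives every `u`. -/
theorem tendsto_heatSemigroup_slope (hR : R.IsPositive) (hR1 : ‖R‖ ≤ 1) (hd : DenseRange R)
    (u : E) :
    Tendsto (fun t : ℝ≥0 => (t : ℝ)⁻¹ • (heatSemigroup R t (R u) - R u)) (𝓝[>] 0)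
      (𝓝 (R u - u)) := by
  set k : ℝ≥0 → ℝ → ℂ := fun t r => (t : ℂ)⁻¹ * (heatFactor t r - 1) with hk
  have hkc : ∀ t, ContinuousOn (k t) (Set.Icc 0 1) := fun t =>
    continuousOn_const.mul ((continuousOn_ofReal_heatFactor t).sub continuousOn_const)
  have hS : ∀ t v, (unitCalc R (k t) * R) v
      = (t : ℝ)⁻¹ • (heatSemigroup R t (R v) - R v) := fun t v => by
    have : unitCalc R (k t) = ((t : ℝ) : ℂ)⁻¹ • (heatSemigroup R t - 1) := by
      have hc := unitCalc_polynomial hR hR1 (Polynomial.C ((t : ℝ) : ℂ)⁻¹)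
      simp only [Polynomial.eval_C, Polynomial.aeval_C] at hc
      simp only [hk]
      rw [unitCalc_mul hR hR1 continuousOn_const
        ((continuousOn_ofReal_heatFactor t).fun_sub continuousOn_const),
        unitCalc_sub hR hR1 (continuousOn_ofReal_heatFactor t) continuousOn_const,
        unitCalc_one hR hR1, Algebra.smul_def, ← hc]
      rfl
    rw [this, ← Complex.ofReal_inv, Complex.coe_smul]
    rfl
  have key : ∀ u, Tendsto (fun t : ℝ≥0 => (unitCalc R (k t) * R) u) (𝓝[>] 0)
      (𝓝 ((R - 1) u)) := by
    refine tendsto_apply_of_denseRange hd (C := 1) ?_ fun v => ?_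
    · filter_upwards [self_mem_nhdsWithin] with t ht
      have ht : (0 : ℝ) < t := NNReal.coe_pos.2 ht
      rw [← unitCalc_mul_id hR hR1 (hkc t)]
      refine norm_unitCalc_le hR hR1 zero_le_one fun r hr => ?_
      have := abs_heatFactor_sub_mul_le le_rfl ht.le hr
      rw [heatFactor_zero, sub_zero, abs_of_pos ht] at this
      have e : k t r * r = (((t : ℝ)⁻¹ * ((heatFactor t r - 1) * r) : ℝ) : ℂ) := by
        simp only [hk]; push_cast; ring
      rw [e, Complex.norm_real, Real.norm_eq_abs, abs_mul, abs_of_pos (inv_pos.2 ht),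
        inv_mul_le_iff₀ ht]
      simpa using this
    · rw [tendsto_iff_norm_sub_tendsto_zero]
      refine squeeze_zero' (.of_forall fun _ => norm_nonneg _) (g := fun t : ℝ≥0 => (t : ℝ) * ‖v‖)
        ?_ ?_
      · filter_upwards [self_mem_nhdsWithin] with t ht
        have ht : (0 : ℝ) < t := NNReal.coe_pos.2 ht
        change ‖(unitCalc R (k t) * R * R) v - ((R - 1) * R) v‖ ≤ _
        rw [← sub_apply]
        refine ContinuousLinearMap.le_of_opNorm_le _ ?_ _
        have h1 : (R - 1) * R = unitCalc R fun r => ((r : ℂ) - 1) * r := by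
          rw [unitCalc_mul_id hR hR1 (by fun_prop),
            unitCalc_sub hR hR1 (by fun_prop) (by fun_prop), unitCalc_id hR hR1,
            unitCalc_one hR hR1]
        have hc : ContinuousOn (fun r : ℝ => k t r * r) (Set.Icc 0 1) := (hkc t).mul (by fun_prop)
        rw [h1, ← unitCalc_mul_id hR hR1 (hkc t), ← unitCalc_mul_id hR hR1 hc,
          ← unitCalc_sub hR hR1 (hc.fun_mul (by fun_prop)) (by fun_prop)]
        refine norm_unitCalc_le hR hR1 ht.le fun r hr => ?_
        have := abs_heatFactor_slope_le ht hr
        rw [← Real.norm_eq_abs, ← Complex.norm_real] at this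
        simpa [hk] using this
      · have : Continuous fun t : ℝ≥0 => (t : ℝ) * ‖v‖ := by fun_prop
        simpa using (this.tendsto 0).mono_left nhdsWithin_le_nhds
  have h := key u
  simp only [hS] at h
  exact h

theorem isSemigroupGeneratedBy_heatSemigroup (hR : R.IsPositive) (hR1 : ‖R‖ ≤ 1)
    (hd : DenseRange R) :
    IsSemigroupGeneratedBy (graphOfResolvent R) (heatSemigroup R) where
  zero := by
    rw [← ContinuousLinearMap.one_def, ← unitCalc_one hR hR1]
    exact congrArg _ (funext fun r => by simp [heatFactor_zero])
  add s t := by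
    change _ = unitCalc R _ * unitCalc R _
    rw [← unitCalc_mul hR hR1 (continuousOn_ofReal_heatFactor s)
      (continuousOn_ofReal_heatFactor t), heatSemigroup]
    refine congrArg _ (funext fun r => ?_)
    rw [NNReal.coe_add, heatFactor_add s.coe_nonneg t.coe_nonneg, Complex.ofReal_mul]
  continuous := continuous_heatSemigroup_apply hR hR1 hd
  generator u f := by
    change u = R (u - f) ↔ _
    constructor
    · intro h
      have := tendsto_heatSemigroup_slope hR hR1 hd (u - f)
      rwa [← h, sub_sub_cancel] at this
    · intro h
      -- The domain is not larger than the range of `R`: applying `R` to the difference quotients,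
      -- which commutes with the semigroup, gives `R f = R u - u`.
      have h1 := (R.continuous.tendsto f).comp h
      have h2 := tendsto_heatSemigroup_slope hR hR1 hd u
      have : (R ∘ fun t : ℝ≥0 => (t : ℝ)⁻¹ • (heatSemigroup R t u - u))
          = fun t : ℝ≥0 => (t : ℝ)⁻¹ • (heatSemigroup R t (R u) - R u) := funext fun t => by
        have hc := DFunLike.congr_fun
          (self_mul_unitCalc hR hR1 (continuousOn_ofReal_heatFactor t)) u
        change R (heatSemigroup R t u) = heatSemigroup R t (R u) at hc
        have hsm : ∀ (c : ℝ) (x : E), R (c • x) = c • R x := fun c x => by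
          rw [← Complex.coe_smul, map_smul, Complex.coe_smul]
        simp only [Function.comp_apply, hsm, map_sub, hc]
      rw [this] at h1
      have := tendsto_nhds_unique h1 h2
      rw [map_sub, this, sub_sub_cancel]

end Semigroup

/-! ### The operator of a form given by an embedding. -/

section EmbeddedForm

open ContinuousLinearMap

variable {E V : Type*} [NormedAddCommGroup E] [InnerProductSpace ℂ E] [CompleteSpace E]
  [NormedAddCommGroup V] [InnerProductSpace ℂ V] [CompleteSpace V] {ι : V →L[ℂ] E}

theorem norm_adjoint_le_one (hι : ‖ι‖ ≤ 1) : ‖adjoint ι‖ ≤ 1 :=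
  (LinearIsometryEquiv.norm_map adjoint ι).trans_le hι

/-- The resolvent at `1` of the operator associated with the form `⟪v, w⟫ - ⟪ι v, ι w⟫`. -/
noncomputable def formResolvent (ι : V →L[ℂ] E) : E →L[ℂ] E := ι ∘SL adjoint ι

theorem isPositive_formResolvent (ι : V →L[ℂ] E) : (formResolvent ι).IsPositive :=
  isPositive_self_comp_adjoint ι

theorem norm_formResolvent_le (hι : ‖ι‖ ≤ 1) : ‖formResolvent ι‖ ≤ 1 :=
  (opNorm_comp_le _ _).trans (mul_le_one₀ hι (norm_nonneg _) (norm_adjoint_le_one hι))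

/-- `ι ι*` is self-adjoint, so its range is dense once its kernel vanishes. If `ι ι* x = 0` then
`‖ι* x‖² = 0`, so `x` is orthogonal to the dense range of `ι`. -/
theorem denseRange_formResolvent (hd : DenseRange ι) : DenseRange (formResolvent ι) := by
  have hsa : adjoint (formResolvent ι) = formResolvent ι := (isPositive_formResolvent ι).isSelfAdjoint
  have hker : (formResolvent ι).range.topologicalClosure = ⊤ := by
    rw [Submodule.topologicalClosure_eq_top_iff, orthogonal_range, hsa, LinearMap.ker_eq_bot']
    intro x hx
    have h0 : adjoint ι x = 0 := by
      rw [← inner_self_eq_zero (𝕜 := ℂ), adjoint_inner_left]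
      change ⟪x, formResolvent ι x⟫_ℂ = 0
      rw [show formResolvent ι x = 0 from hx, inner_zero_right]
    refine hd.eq_zero_of_inner_left ℂ (x := x) ?_
    intro v
    rw [← adjoint_inner_left, h0, inner_zero_left]
  intro x
  have : x ∈ (formResolvent ι).range.topologicalClosure := hker ▸ Submodule.mem_top
  exact this

/-- The error does not depend on `ι`, so one polynomial serves for all `n` at once. -/
theorem norm_unitCalc_sub_aeval_le (hι : ‖ι‖ ≤ 1) {k : ℝ → ℂ}
    (hk : ContinuousOn k (Set.Icc 0 1)) {p : Polynomial ℂ} {δ : ℝ} (hδ : 0 ≤ δ)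
    (hp : ∀ r ∈ Set.Icc (0 : ℝ) 1, ‖k r - p.eval (r : ℂ)‖ ≤ δ) (x : E) :
    ‖unitCalc (formResolvent ι) k x - Polynomial.aeval (formResolvent ι) p x‖ ≤ δ * ‖x‖ := by
  have hpos := isPositive_formResolvent ι
  have h1 := norm_formResolvent_le hι
  rw [← unitCalc_polynomial hpos h1, ← sub_apply, ← unitCalc_sub hpos h1 hk (by fun_prop)]
  exact le_of_opNorm_le _ (norm_unitCalc_le hpos h1 hδ hp) x

end EmbeddedForm

/-! ### Convergence of vectors in varying spaces. -/

section DiscreteConvergence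

variable {K K' L L' : Type*} {Kn Ln : ℕ → Type*}
  [NormedAddCommGroup K] [NormedSpace ℂ K] [NormedAddCommGroup K'] [NormedSpace ℂ K']
  [∀ n, NormedAddCommGroup (Kn n)] [∀ n, NormedSpace ℂ (Kn n)]
  [NormedAddCommGroup L] [NormedSpace ℂ L] [NormedAddCommGroup L'] [NormedSpace ℂ L']
  [∀ n, NormedAddCommGroup (Ln n)] [∀ n, NormedSpace ℂ (Ln n)]
  {J : ∀ n, K →L[ℂ] Kn n} {J' : K →L[ℂ] K'} {I : ∀ n, L →L[ℂ] Ln n} {I' : L →L[ℂ] L'}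

/-- Convergence of a sequence in varying spaces `Kn n`, compared through maps `J n`, `J'` of a
common space: both `f n` and `g` are approximated by the images of one vector. -/
def DiscreteTendsto (J : ∀ n, K →L[ℂ] Kn n) (J' : K →L[ℂ] K') (f : ∀ n, Kn n) (g : K') : Prop :=
  ∀ ε > 0, ∃ F : K, ‖g - J' F‖ < ε ∧ ∀ᶠ n in atTop, ‖f n - J n F‖ < ε

namespace DiscreteTendsto

theorem image (F : K) : DiscreteTendsto J J' (fun n => J n F) (J' F) := fun ε hε =>
  ⟨F, by simpa using hε, .of_forall fun n => by simpa using hε⟩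

theorem add {f f' : ∀ n, Kn n} {g g' : K'} (h : DiscreteTendsto J J' f g)
    (h' : DiscreteTendsto J J' f' g') :
    DiscreteTendsto J J' (fun n => f n + f' n) (g + g') := by
  intro ε hε
  obtain ⟨F, h1, h2⟩ := h (ε / 2) (by positivity)
  obtain ⟨F', h1', h2'⟩ := h' (ε / 2) (by positivity)
  refine ⟨F + F', ?_, ?_⟩
  · rw [map_add, add_sub_add_comm]
    exact (norm_add_le _ _).trans_lt (by linarith)
  · filter_upwards [h2, h2'] with n hn hn'
    rw [map_add, add_sub_add_comm]
    exact (norm_add_le _ _).trans_lt (by linarith)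

theorem const_smul {f : ∀ n, Kn n} {g : K'} (h : DiscreteTendsto J J' f g) (c : ℂ) :
    DiscreteTendsto J J' (fun n => c • f n) (c • g) := by
  intro ε hε
  obtain ⟨F, h1, h2⟩ := h (ε / (‖c‖ + 1)) (by positivity)
  have key : ∀ x : ℝ, 0 ≤ x → x < ε / (‖c‖ + 1) → ‖c‖ * x < ε := fun x hx0 hx => by
    rw [lt_div_iff₀ (by positivity)] at hx
    nlinarith
  refine ⟨c • F, ?_, ?_⟩
  · rw [map_smul, ← smul_sub, norm_smul]
    exact key _ (norm_nonneg _) h1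
  · filter_upwards [h2] with n hn
    rw [map_smul, ← smul_sub, norm_smul]
    exact key _ (norm_nonneg _) hn

theorem of_uniform_approx {f : ∀ n, Kn n} {g : K'}
    (h : ∀ ε > 0, ∃ (f' : ∀ n, Kn n) (g' : K'), DiscreteTendsto J J' f' g' ∧ ‖g - g'‖ ≤ ε ∧
      ∀ n, ‖f n - f' n‖ ≤ ε) : DiscreteTendsto J J' f g := by
  intro ε hε
  obtain ⟨f', g', h', hg, hf⟩ := h (ε / 2) (by positivity)
  obtain ⟨F, h1, h2⟩ := h' (ε / 2) (by positivity)
  refine ⟨F, ?_, ?_⟩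
  · exact (norm_sub_le_norm_sub_add_norm_sub _ g' _).trans_lt (by linarith)
  · filter_upwards [h2] with n hn
    exact (norm_sub_le_norm_sub_add_norm_sub _ (f' n) _).trans_lt (by linarith [hf n])

/-- Since the operators are contractions, their convergence needs checking only on the images of a
fixed vector. -/
theorem map {B : ∀ n, Kn n →L[ℂ] Ln n} {B' : K' →L[ℂ] L'} (hB : ∀ n, ‖B n‖ ≤ 1)
    (hB' : ‖B'‖ ≤ 1) (hBJ : ∀ F, DiscreteTendsto I I' (fun n => B n (J n F)) (B' (J' F)))
    {f : ∀ n, Kn n} {g : K'} (h : DiscreteTendsto J J' f g) :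
    DiscreteTendsto I I' (fun n => B n (f n)) (B' g) := by
  intro ε hε
  obtain ⟨F, h1, h2⟩ := h (ε / 2) (by positivity)
  obtain ⟨v, h3, h4⟩ := hBJ F (ε / 2) (by positivity)
  refine ⟨v, ?_, ?_⟩
  · refine (norm_sub_le_norm_sub_add_norm_sub _ (B' (J' F)) _).trans_lt ?_
    rw [← map_sub]
    linarith [B'.le_of_opNorm_le hB' (g - J' F)]
  · filter_upwards [h2, h4] with n hn hn'
    refine (norm_sub_le_norm_sub_add_norm_sub _ (B n (J n F)) _).trans_lt ?_
    rw [← map_sub]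
    linarith [(B n).le_of_opNorm_le (hB n) (f n - J n F)]

end DiscreteTendsto

end DiscreteConvergence

/-! ### Convergence of adjoint embeddings and of functions of the resolvents. -/

section Restriction

open ContinuousLinearMap

variable {K K' : Type*} {Kn : ℕ → Type*}
  [NormedAddCommGroup K] [InnerProductSpace ℂ K]
  [NormedAddCommGroup K'] [InnerProductSpace ℂ K']
  [∀ n, NormedAddCommGroup (Kn n)] [∀ n, InnerProductSpace ℂ (Kn n)]

/-- Contractions `J n` from `K` and `σ n` to `K'` that behave like the restrictions of functions
to sets decreasing in measure. -/
structure IsRestrictionSystem (J : ∀ n, K →L[ℂ] Kn n) (J' : K →L[ℂ] K')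
    (σ : ∀ n, Kn n →L[ℂ] K') : Prop where
  apply_apply : ∀ n x, σ n (J n x) = J' x
  norm_le : ∀ n, ‖σ n‖ ≤ 1
  tendsto_norm : ∀ x, Tendsto (fun n => ‖J n x‖) atTop (𝓝 ‖J' x‖)

variable {J : ∀ n, K →L[ℂ] Kn n} {J' : K →L[ℂ] K'} {σ : ∀ n, Kn n →L[ℂ] K'}

theorem IsRestrictionSystem.tendsto_of_discreteTendsto (h : IsRestrictionSystem J J' σ)
    {f : ∀ n, Kn n} {g : K'} (hf : DiscreteTendsto J J' f g) :
    Tendsto (fun n => σ n (f n)) atTop (𝓝 g) := by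
  rw [Metric.tendsto_nhds]
  intro ε hε
  obtain ⟨F, h1, h2⟩ := hf (ε / 2) (by positivity)
  filter_upwards [h2] with n hn
  rw [dist_eq_norm]
  refine (norm_sub_le_norm_sub_add_norm_sub _ (J' F) _).trans_lt ?_
  rw [norm_sub_rev (J' F) g, ← h.apply_apply n F, ← map_sub, h.apply_apply]
  linarith [(σ n).le_of_opNorm_le (h.norm_le n) (f n - J n F)]

variable [CompleteSpace K'] [∀ n, CompleteSpace (Kn n)]

/-- For restrictions in `L²` the adjoint of `σ n` is extension by zero. In general, expanding the
square and using `⟪J n x, (σ n)* J' x⟫ = ‖J' x‖²` bounds it by `‖J n x‖² - ‖J' x‖²`. -/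
theorem IsRestrictionSystem.tendsto_norm_sub_adjoint (h : IsRestrictionSystem J J' σ) (x : K) :
    Tendsto (fun n => ‖J n x - adjoint (σ n) (J' x)‖) atTop (𝓝 0) := by
  have h1 : Tendsto (fun n => √(‖J n x‖ ^ 2 - ‖J' x‖ ^ 2)) atTop (𝓝 0) := by
    have := (((h.tendsto_norm x).pow 2).sub_const (‖J' x‖ ^ 2)).sqrt
    simpa using this
  refine squeeze_zero (fun _ => norm_nonneg _) (fun n => Real.le_sqrt_of_sq_le ?_) h1
  have h2 : RCLike.re ⟪J n x, adjoint (σ n) (J' x)⟫_ℂ = ‖J' x‖ ^ 2 := by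
    rw [adjoint_inner_right, h.apply_apply, inner_self_eq_norm_sq]
  have h3 : ‖adjoint (σ n) (J' x)‖ ≤ ‖J' x‖ := by
    simpa using (adjoint (σ n)).le_of_opNorm_le (norm_adjoint_le_one (h.norm_le n)) (J' x)
  rw [norm_sub_sq (𝕜 := ℂ), h2]
  nlinarith [norm_nonneg (adjoint (σ n) (J' x))]

variable {W W' : Type*} {Wn : ℕ → Type*}
  [NormedAddCommGroup W] [InnerProductSpace ℂ W]
  [NormedAddCommGroup W'] [InnerProductSpace ℂ W'] [CompleteSpace W']
  [∀ n, NormedAddCommGroup (Wn n)] [∀ n, InnerProductSpace ℂ (Wn n)] [∀ n, CompleteSpace (Wn n)]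
  {P : ∀ n, W →L[ℂ] Wn n} {P' : W →L[ℂ] W'} {ρ : ∀ n, Wn n →L[ℂ] W'}
  {ι : W →L[ℂ] K} {ιn : ∀ n, Wn n →L[ℂ] Kn n} {ι' : W' →L[ℂ] K'}

/-- Convergence of the solutions of the variational problems `⟪v, w⟫ = ⟪ι v, f⟫` (a form of Céa's
lemma). -/
theorem discreteTendsto_adjoint_image (hJ : IsRestrictionSystem J J' σ)
    (hP : IsRestrictionSystem P P' ρ) (hd : DenseRange P')
    (hιn : ∀ n, ‖ιn n‖ ≤ 1) (hcomm : ∀ n, σ n ∘SL ιn n = ι' ∘SL ρ n) (F : K) :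
    DiscreteTendsto P P' (fun n => adjoint (ιn n) (J n F)) (adjoint ι' (J' F)) := by
  intro ε hε
  -- The limit solution need not lie in the range of `P'`; its approximation `v` is the common
  -- vector behind both sequences.
  obtain ⟨v, hv⟩ := hd.exists_dist_lt (adjoint ι' (J' F)) (show 0 < ε / 2 by positivity)
  rw [dist_eq_norm] at hv
  refine ⟨v, by linarith, ?_⟩
  filter_upwards [(hJ.tendsto_norm_sub_adjoint F).eventually_lt_const
      (show 0 < ε / 4 by positivity),
    (hP.tendsto_norm_sub_adjoint v).eventually_lt_const (show 0 < ε / 4 by positivity)]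
    with n h1 h2
  -- The adjoint of the commuting square transports the limit solution to level `n`. Hence only the
  -- errors of replacing `J n`, `P n` by adjoint restrictions and that of `v` remain.
  have hadj : adjoint (ιn n) (adjoint (σ n) (J' F)) = adjoint (ρ n) (adjoint ι' (J' F)) := by
    have := congrArg adjoint (hcomm n)
    rw [adjoint_comp, adjoint_comp] at this
    exact DFunLike.congr_fun this (J' F)
  have e : adjoint (ιn n) (J n F) - P n v = adjoint (ιn n) (J n F - adjoint (σ n) (J' F))
      - (P n v - adjoint (ρ n) (P' v)) + adjoint (ρ n) (adjoint ι' (J' F) - P' v) := by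
    rw [map_sub, map_sub, hadj]; abel
  rw [e]
  have b1 := (adjoint (ιn n)).le_of_opNorm_le (norm_adjoint_le_one (hιn n)) (J n F - adjoint (σ n) (J' F))
  have b2 := (adjoint (ρ n)).le_of_opNorm_le (norm_adjoint_le_one (hP.norm_le n)) (adjoint ι' (J' F) - P' v)
  refine (norm_add_le _ _).trans_lt ?_
  linarith [norm_sub_le (adjoint (ιn n) (J n F - adjoint (σ n) (J' F))) (P n v - adjoint (ρ n) (P' v))]

/-- Strong convergence of the functions `k (R_n)` of the resolvents at `1`, in the form norm. -/
theorem discreteTendsto_unitCalc (hJ : IsRestrictionSystem J J' σ)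
    (hP : IsRestrictionSystem P P' ρ) (hd : DenseRange P')
    (hιn : ∀ n, ‖ιn n‖ ≤ 1) (hι' : ‖ι'‖ ≤ 1) (hcomm : ∀ n, σ n ∘SL ιn n = ι' ∘SL ρ n)
    (hιP : ∀ n v, ιn n (P n v) = J n (ι v)) (hιP' : ∀ v, ι' (P' v) = J' (ι v))
    {k : ℝ → ℂ} (hk : ContinuousOn k (Set.Icc 0 1)) (F : K) :
    DiscreteTendsto P P' (fun n => adjoint (ιn n) (unitCalc (formResolvent (ιn n)) k (J n F)))
      (adjoint ι' (unitCalc (formResolvent ι') k (J' F))) := by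
  have hS : ∀ {f : ∀ n, Kn n} {g : K'}, DiscreteTendsto J J' f g →
      DiscreteTendsto P P' (fun n => adjoint (ιn n) (f n)) (adjoint ι' g) := fun h =>
    h.map (fun n => norm_adjoint_le_one (hιn n)) (norm_adjoint_le_one hι')
      (discreteTendsto_adjoint_image hJ hP hd hιn hcomm)
  -- Each resolvent is `ιn` after `ιn*`: convergence passes to the form spaces by `hS` and back
  -- because the embeddings respect common vectors.
  have hR : ∀ {f : ∀ n, Kn n} {g : K'}, DiscreteTendsto J J' f g →
      DiscreteTendsto J J' (fun n => formResolvent (ιn n) (f n)) (formResolvent ι' g) := fun h => by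
    refine (hS h).map hιn hι' fun v => ?_
    simp only [hιP, hιP']
    exact .image (ι v)
  have hpow : ∀ m : ℕ, DiscreteTendsto J J' (fun n => (formResolvent (ιn n) ^ m) (J n F))
      ((formResolvent ι' ^ m) (J' F)) := by
    intro m
    induction m with
    | zero => simpa using DiscreteTendsto.image F
    | succ m ih =>
      simp only [pow_succ']
      exact hR ih
  have hpoly : ∀ p : Polynomial ℂ,
      DiscreteTendsto J J' (fun n => Polynomial.aeval (formResolvent (ιn n)) p (J n F))
        (Polynomial.aeval (formResolvent ι') p (J' F)) := by
    intro p
    induction p using Polynomial.induction_on' with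
    | add p q hp hq =>
      simp only [map_add, add_apply]
      exact hp.add hq
    | monomial m c =>
      simp only [Polynomial.aeval_monomial, ← Algebra.smul_def, smul_apply]
      exact (hpow m).const_smul c
  refine hS (.of_uniform_approx fun ε hε => ?_)
  -- `C` bounds `‖J n F‖` for all `n` and `‖J' F‖`, so accuracy `ε / C` of the polynomial suffices
  -- uniformly; the `1` makes `C` positive.
  set C := sSup (Set.range fun n => ‖J n F‖) + ‖J' F‖ + 1 with hC
  have hbdd : BddAbove (Set.range fun n => ‖J n F‖) := (hJ.tendsto_norm F).bddAbove_range
  have hC1 : ∀ n, ‖J n F‖ ≤ C := fun n =>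
    (le_csSup hbdd ⟨n, rfl⟩).trans (by linarith [norm_nonneg (J' F)])
  have hs0 : 0 ≤ sSup (Set.range fun n => ‖J n F‖) :=
    (norm_nonneg (J 0 F)).trans (le_csSup hbdd ⟨0, rfl⟩)
  have hC2 : ‖J' F‖ ≤ C := by linarith
  have hC0 : 0 < C := by linarith [norm_nonneg (J' F)]
  obtain ⟨p, hp⟩ := exists_complex_polynomial_near hk (show 0 < ε / C by positivity)
  have key : ∀ x : ℝ, x ≤ C → ε / C * x ≤ ε := fun x hx => by
    calc ε / C * x ≤ ε / C * C := by gcongr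
      _ = ε := div_mul_cancel₀ _ hC0.ne'
  exact ⟨_, _, hpoly p,
    (norm_unitCalc_sub_aeval_le hι' hk (by positivity) hp _).trans (key _ hC2), fun n =>
    (norm_unitCalc_sub_aeval_le (hιn n) hk (by positivity) hp _).trans (key _ (hC1 n))⟩

end Restriction

/-! ### Restriction operators on `L²`. -/

section RestrictLp

variable {X F : Type*} [MeasurableSpace X] [NormedAddCommGroup F] [NormedSpace ℂ F]
  {μ ν κ : Measure X}

/-- The restriction `L²(μ) → L²(ν)` for `ν ≤ μ`. -/
noncomputable def restrictLp (F : Type*) [NormedAddCommGroup F] [NormedSpace ℂ F] (h : ν ≤ μ) :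
    Lp F 2 μ →L[ℂ] Lp F 2 ν :=
  LinearMap.mkContinuous
    { toFun := fun f => ((Lp.memLp f).mono_measure h).toLp f
      map_add' := fun f g => by
        rw [← MemLp.toLp_add]
        exact MemLp.toLp_congr _ _ ((Measure.absolutelyContinuous_of_le h).ae_le (Lp.coeFn_add f g))
      map_smul' := fun c f => by
        rw [RingHom.id_apply, ← MemLp.toLp_const_smul]
        exact MemLp.toLp_congr _ _
          ((Measure.absolutelyContinuous_of_le h).ae_le (Lp.coeFn_smul c f)) }
    1 fun f => by
      rw [one_mul]
      change ‖((Lp.memLp f).mono_measure h).toLp f‖ ≤ _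
      rw [Lp.norm_toLp, Lp.norm_def]
      exact ENNReal.toReal_mono (Lp.eLpNorm_ne_top f) (eLpNorm_mono_measure _ h)

theorem coeFn_restrictLp (h : ν ≤ μ) (f : Lp F 2 μ) : restrictLp F h f =ᵐ[ν] f :=
  MemLp.coeFn_toLp ((Lp.memLp f).mono_measure h)

theorem norm_restrictLp (h : ν ≤ μ) (f : Lp F 2 μ) :
    ‖restrictLp F h f‖ = (eLpNorm f 2 ν).toReal :=
  Lp.norm_toLp _ ((Lp.memLp f).mono_measure h)

theorem norm_restrictLp_apply_le (h : ν ≤ μ) (f : Lp F 2 μ) : ‖restrictLp F h f‖ ≤ ‖f‖ := by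
  rw [norm_restrictLp, Lp.norm_def]
  exact ENNReal.toReal_mono (Lp.eLpNorm_ne_top f) (eLpNorm_mono_measure _ h)

theorem norm_restrictLp_le (h : ν ≤ μ) : ‖restrictLp F h‖ ≤ 1 :=
  LinearMap.mkContinuous_norm_le _ zero_le_one _

theorem restrictLp_restrictLp (h : ν ≤ μ) (h' : κ ≤ ν) (h'' : κ ≤ μ) (f : Lp F 2 μ) :
    restrictLp F h' (restrictLp F h f) = restrictLp F h'' f :=
  MemLp.toLp_congr ((Lp.memLp _).mono_measure h') ((Lp.memLp f).mono_measure h'')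
    ((Measure.absolutelyContinuous_of_le h').ae_le (coeFn_restrictLp h f))

end RestrictLp

/-! ### Norms over sets decreasing in measure. -/

section Measure

variable {X F : Type*} [MeasurableSpace X] [NormedAddCommGroup F] [NormedSpace ℂ F]
  {μ : Measure X}

/-- Absolute continuity of the integral makes the part over `An n \ A` vanish in the limit. -/
theorem tendsto_setLIntegral_of_tendsto_measure_diff {g : X → ENNReal} (hg : ∫⁻ x, g x ∂μ ≠ ⊤)
    {A : Set X} {An : ℕ → Set X} (hA : ∀ n, A ⊆ An n)
    (h : Tendsto (fun n => μ (An n \ A)) atTop (𝓝 0)) :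
    Tendsto (fun n => ∫⁻ x in An n, g x ∂μ) atTop (𝓝 (∫⁻ x in A, g x ∂μ)) := by
  have h1 := (tendsto_setLIntegral_zero hg h).const_add (∫⁻ x in A, g x ∂μ)
  rw [add_zero] at h1
  refine tendsto_of_tendsto_of_tendsto_of_le_of_le tendsto_const_nhds h1
    (fun n => lintegral_mono_set (hA n)) fun n => ?_
  have : An n = A ∪ An n \ A := (Set.union_sdiff_cancel (hA n)).symm
  conv_lhs => rw [this]
  exact lintegral_union_le _ _ _

/-- The measure `ν`, equal to `μ` only propositionally, allows `f` to live over `γ.restrict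
Set.univ`, where the functions on the whole space are taken. -/
theorem tendsto_norm_restrictLp {ν : Measure X} (f : Lp F 2 ν) {A : Set X} {An : ℕ → Set X}
    (hμ : ν = μ) (hA : ∀ n, A ⊆ An n) (h : Tendsto (fun n => μ (An n \ A)) atTop (𝓝 0))
    (hn : ∀ n, μ.restrict (An n) ≤ ν) (h' : μ.restrict A ≤ ν) :
    Tendsto (fun n => ‖restrictLp F (hn n) f‖) atTop (𝓝 ‖restrictLp F h' f‖) := by
  subst hμ
  have key := eLpNorm_lt_top_iff_lintegral_rpow_enorm_lt_top (p := 2) (by simp) (by simp)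
    |>.1 (Lp.eLpNorm_lt_top f)
  simp only [norm_restrictLp]
  refine (ENNReal.tendsto_toReal ((eLpNorm_mono_measure _ h').trans_lt
    (Lp.eLpNorm_lt_top f)).ne).comp ?_
  simp only [eLpNorm_eq_lintegral_rpow_enorm_toReal (p := 2) (by simp) (by simp)]
  exact (ENNReal.continuous_rpow_const.tendsto _).comp
    (tendsto_setLIntegral_of_tendsto_measure_diff key.ne hA h)

end Measure

/-! ### Restriction and embedding of `W^{1,2}`. -/

section Pair

variable {X : Type*} [NormedAddCommGroup X] [NormedSpace ℝ X] [MeasurableSpace X]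
  {γ : Measure X} {A B C Ω : Set X}

namespace L2Pair

theorem norm_sq_eq (w : L2Pair γ Ω) : ‖w‖ ^ 2 = ‖w.fn‖ ^ 2 + ‖w.grad‖ ^ 2 :=
  WithLp.prod_norm_sq_eq_of_L2 (α := L2 γ Ω) (β := L2H γ Ω) w

theorem norm_fn_le (w : L2Pair γ Ω) : ‖w.fn‖ ≤ ‖w‖ :=
  le_of_sq_le_sq (by rw [norm_sq_eq]; linarith [sq_nonneg ‖w.grad‖]) (norm_nonneg _)

/-- The pair `(u, g)`. -/
def mk (u : L2 γ Ω) (g : L2H γ Ω) : L2Pair γ Ω := WithLp.toLp 2 (u, g)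

theorem ext {v w : L2Pair γ Ω} (h : v.fn = w.fn) (h' : v.grad = w.grad) : v = w :=
  (WithLp.ofLp_injective 2) (Prod.ext h h')

/-- The restriction of pairs from `B` to a subset `A`, as a linear map. -/
noncomputable def restrictₗ (h : A ⊆ B) : L2Pair γ B →ₗ[ℂ] L2Pair γ A where
  toFun w := mk (restrictLp ℂ (Measure.restrict_mono h le_rfl) w.fn)
    (restrictLp (CameronMartinC γ) (Measure.restrict_mono h le_rfl) w.grad)
  map_add' v w := ext (map_add (restrictLp ℂ _) v.fn w.fn)
    (map_add (restrictLp (CameronMartinC γ) _) v.grad w.grad)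
  map_smul' c w := ext (map_smul (restrictLp ℂ _) c w.fn)
    (map_smul (restrictLp (CameronMartinC γ) _) c w.grad)

theorem norm_restrictₗ_le (h : A ⊆ B) (w : L2Pair γ B) : ‖restrictₗ h w‖ ≤ ‖w‖ := by
  have h1 : ‖(restrictₗ h w).fn‖ ≤ ‖w.fn‖ :=
    norm_restrictLp_apply_le (Measure.restrict_mono h le_rfl) w.fn
  have h2 : ‖(restrictₗ h w).grad‖ ≤ ‖w.grad‖ :=
    norm_restrictLp_apply_le (Measure.restrict_mono h le_rfl) w.grad
  refine le_of_sq_le_sq ?_ (norm_nonneg w)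
  rw [norm_sq_eq w, norm_sq_eq]
  gcongr

/-- The restriction of pairs from `B` to a subset `A`. -/
noncomputable def restrict (h : A ⊆ B) : L2Pair γ B →L[ℂ] L2Pair γ A :=
  (restrictₗ h).mkContinuous 1 fun w => by
    rw [one_mul]
    exact norm_restrictₗ_le h w

theorem norm_restrict_apply_le (h : A ⊆ B) (w : L2Pair γ B) : ‖restrict h w‖ ≤ ‖w‖ :=
  norm_restrictₗ_le h w

theorem restrict_restrict (h : A ⊆ B) (h' : B ⊆ C) (h'' : A ⊆ C) (w : L2Pair γ C) :
    restrict h (restrict h' w) = restrict h'' w :=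
  ext (restrictLp_restrictLp _ _ _ _) (restrictLp_restrictLp _ _ _ _)

end L2Pair

theorem restrict_mem_lipschitzGraph (h : A ⊆ B) {w : L2Pair γ B} (hw : w ∈ lipschitzGraph γ B) :
    L2Pair.restrict h w ∈ lipschitzGraph γ A := by
  obtain ⟨u, G, hK, hG, hd, h1, h2⟩ := hw
  have hac := Measure.absolutelyContinuous_of_le (Measure.restrict_mono (μ := γ) h le_rfl)
  exact ⟨u, G, hK, hG, hd, (coeFn_restrictLp _ _).trans (hac.ae_le h1),
    (coeFn_restrictLp _ _).trans (hac.ae_le h2)⟩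

theorem restrict_mem_W12 (h : A ⊆ B) {w : L2Pair γ B} (hw : w ∈ W12 γ B) :
    L2Pair.restrict h w ∈ W12 γ A :=
  map_mem_closure (L2Pair.restrict h).continuous hw fun _ hv => restrict_mem_lipschitzGraph h hv

/-- The restriction `W^{1,2}(B, γ) → W^{1,2}(A, γ)` for `A ⊆ B`. -/
noncomputable def W12.restrict (h : A ⊆ B) : W12 γ B →L[ℂ] W12 γ A :=
  ((L2Pair.restrict h).comp (W12 γ B).subtypeL).codRestrict (W12 γ A)
    fun w => restrict_mem_W12 h w.2

/-- The embedding `W^{1,2}(Ω, γ) → L²(Ω, γ)`. -/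
noncomputable def W12.embed (γ : Measure X) (Ω : Set X) : W12 γ Ω →L[ℂ] L2 γ Ω :=
  LinearMap.mkContinuous
    { toFun := fun w => (w : L2Pair γ Ω).fn
      map_add' := fun _ _ => rfl
      map_smul' := fun _ _ => rfl }
    1 fun w => by
      rw [one_mul]
      exact L2Pair.norm_fn_le (w : L2Pair γ Ω)

theorem W12.embed_apply (w : W12 γ Ω) : W12.embed γ Ω w = (w : L2Pair γ Ω).fn := rfl

theorem W12.norm_embed_le : ‖W12.embed γ Ω‖ ≤ 1 := LinearMap.mkContinuous_norm_le _ zero_le_one _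

theorem W12.norm_restrict_le (h : A ⊆ B) : ‖W12.restrict (γ := γ) h‖ ≤ 1 :=
  ContinuousLinearMap.opNorm_le_bound _ zero_le_one fun w => by
    rw [one_mul]
    exact L2Pair.norm_restrict_apply_le h (w : L2Pair γ B)

/-- Adding `⟪v, u⟫` in `L²` to the weak equation gives the full `W^{1,2}` inner product on the left
and `⟪ι v, u - f⟫` on the right, which says `u = ι* (u - f)`. -/
theorem ouGraph_eq (γ : Measure X) (Ω : Set X) :
    ouGraph γ Ω = graphOfResolvent (formResolvent (W12.embed γ Ω)) := by
  have key : ∀ (u : W12 γ Ω) (p : L2 γ Ω × L2 γ Ω), (u : L2Pair γ Ω).fn = p.1 →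
      ((∀ v : W12 γ Ω, dirichletForm γ Ω u v = -⟪(v : L2Pair γ Ω).fn, p.2⟫_ℂ) ↔
        u = ContinuousLinearMap.adjoint (W12.embed γ Ω) (p.1 - p.2)) := fun u p hu => by
    rw [ext_iff_inner_left ℂ]
    refine forall_congr' fun v => ?_
    rw [ContinuousLinearMap.adjoint_inner_right, Submodule.coe_inner, L2Pair.inner_eq, hu,
      inner_sub_right, W12.embed_apply, sub_eq_add_neg, add_right_inj]
    rfl
  ext p
  constructor
  · rintro ⟨u, hu, h⟩
    exact hu.symm.trans (congrArg (W12.embed γ Ω) ((key u p hu).1 h))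
  · intro h
    exact ⟨_, h.symm, (key _ p h.symm).2 rfl⟩

end Pair

/-! ### Lipschitz functions have bounded gradients along `H`; density of restrictions from `X`. -/

section GradientBound

theorem memLp_of_lipschitzWith {X : Type*} [NormedAddCommGroup X] [MeasurableSpace X]
    [OpensMeasurableSpace X] [SecondCountableTopology X] {γ : Measure X} [IsFiniteMeasure γ]
    (h2 : MemLp id 2 γ) {u : X → ℂ} {K : ℝ≥0}
    (hu : LipschitzWith K u) : MemLp u 2 γ := by
  refine ((memLp_const (‖u 0‖ : ℝ)).add (h2.norm.const_mul (K : ℝ))).mono'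
    hu.continuous.aestronglyMeasurable (.of_forall fun x => ?_)
  have := hu.norm_sub_le x 0
  have h3 := norm_sub_norm_le (u x) (u 0)
  rw [sub_zero] at this
  simp
  linarith

variable {X : Type*} [NormedAddCommGroup X] [NormedSpace ℝ X] [MeasurableSpace X]
  {γ : Measure X}

theorem integrable_smul_id (h2 : MemLp id 2 γ) (φ : Lp ℝ 2 γ) :
    Integrable (fun x => φ x • x) γ :=
  memLp_one_iff_integrable.1 (h2.smul (Lp.memLp φ) (r := 1))

theorem norm_cmVector_le (h2 : MemLp id 2 γ) (φ : Lp ℝ 2 γ) :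
    ‖cmVector γ φ‖ ≤ (eLpNorm id 2 γ).toReal * ‖φ‖ := by
  rw [Lp.norm_def, ← ENNReal.toReal_mul, ← toReal_enorm]
  refine ENNReal.toReal_mono (ENNReal.mul_ne_top h2.eLpNorm_ne_top (Lp.eLpNorm_ne_top φ)) ?_
  refine (enorm_integral_le_lintegral_enorm _).trans ?_
  rw [← eLpNorm_one_eq_lintegral_enorm, mul_comm]
  exact eLpNorm_smul_le_mul_eLpNorm (r := 1) h2.1 (Lp.aestronglyMeasurable φ)

/-- A directional derivative is at most `K ‖h‖` in the norm of `X`, and `H` embeds continuously in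
`X` by Cauchy-Schwarz. -/
theorem norm_le_of_lipschitzWith_of_isHGradientAt (h2 : MemLp id 2 γ) {u : X → ℂ} {K : ℝ≥0}
    (hu : LipschitzWith K u) {g : CameronMartinC γ} {x : X} (hg : IsHGradientAt γ u g x)
    {φ : Lp ℝ 2 γ} (hφ : φ ∈ reproducingSpace γ) :
    ‖pairing γ φ g‖ ≤ K * (eLpNorm id 2 γ).toReal * ‖φ‖ := by
  have hl : LipschitzWith (K * ‖cmVector γ φ‖₊) fun t : ℝ => u (x + t • cmVector γ φ) :=
    hu.comp (LipschitzWith.of_dist_le_mul fun s t => by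
      rw [dist_add_left, dist_eq_norm, dist_eq_norm, ← sub_smul, norm_smul, mul_comm, coe_nnnorm])
  refine ((hg φ hφ).le_of_lipschitz hl).trans ?_
  rw [NNReal.coe_mul, coe_nnnorm, mul_assoc]
  gcongr
  exact norm_cmVector_le h2 φ

theorem exists_dual_of_mem_span {ψ : Lp ℂ 2 γ} (hψ : ψ ∈ Submodule.span ℂ
    {φ : Lp ℂ 2 γ | ∃ l : StrongDual ℝ X, φ =ᵐ[γ] fun x => (l x : ℂ)}) :
    ∃ a b : StrongDual ℝ X, ψ =ᵐ[γ] fun x => (a x : ℂ) + Complex.I * b x := by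
  induction hψ using Submodule.span_induction with
  | mem φ h =>
    obtain ⟨l, hl⟩ := h
    exact ⟨l, 0, by simpa using hl⟩
  | zero => exact ⟨0, 0, by simpa using! Lp.coeFn_zero ℂ 2 γ⟩
  | add φ ψ _ _ hφ hψ =>
    obtain ⟨a, b, h⟩ := hφ
    obtain ⟨a', b', h'⟩ := hψ
    refine ⟨a + a', b + b', ?_⟩
    filter_upwards [Lp.coeFn_add φ ψ, h, h'] with x hx h1 h2
    rw [hx, Pi.add_apply, h1, h2]
    simp
    ring
  | smul c φ _ hφ =>
    obtain ⟨a, b, h⟩ := hφ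
    refine ⟨c.re • a - c.im • b, c.re • b + c.im • a, ?_⟩
    filter_upwards [Lp.coeFn_smul c φ, h] with x hx h1
    rw [hx, Pi.smul_apply, h1]
    apply Complex.ext <;> simp

/-- The gradient is tested only against real directions; splitting `ψ` into real and imaginary
parts, each of norm at most `‖ψ‖`, costs the factor `2`. -/
theorem norm_inner_le_of_norm_pairing_le {g : CameronMartinC γ} {C : ℝ} (hC : 0 ≤ C)
    (h : ∀ φ ∈ reproducingSpace γ, ‖pairing γ φ g‖ ≤ C * ‖φ‖) {ψ : Lp ℂ 2 γ} {a b : StrongDual ℝ X}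
    (hψ : ψ =ᵐ[γ] fun x => (a x : ℂ) + Complex.I * b x) :
    ‖⟪ψ, (g : Lp ℂ 2 γ)⟫_ℂ‖ ≤ 2 * C * ‖ψ‖ := by
  have hre : (fun x => (ψ x).re) =ᵐ[γ] a := by
    filter_upwards [hψ] with x hx
    simp [hx]
  have him : (fun x => (ψ x).im) =ᵐ[γ] b := by
    filter_upwards [hψ] with x hx
    simp [hx]
  have ha : MemLp a 2 γ := (Lp.memLp ψ).re.ae_eq hre
  have hb : MemLp b 2 γ := (Lp.memLp ψ).im.ae_eq him
  have hmem : ∀ (l : StrongDual ℝ X) (hl : MemLp l 2 γ), hl.toLp l ∈ reproducingSpace γ :=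
    fun l hl => Submodule.le_topologicalClosure _ (Submodule.subset_span ⟨l, hl.coeFn_toLp⟩)
  have hna : ‖ha.toLp a‖ ≤ ‖ψ‖ := by
    refine Lp.norm_le_norm_of_ae_le ?_
    filter_upwards [ha.coeFn_toLp, hre] with x h1 h2
    rw [h1, ← h2]
    exact Complex.abs_re_le_norm _
  have hnb : ‖hb.toLp b‖ ≤ ‖ψ‖ := by
    refine Lp.norm_le_norm_of_ae_le ?_
    filter_upwards [hb.coeFn_toLp, him] with x h1 h2
    rw [h1, ← h2]
    exact Complex.abs_im_le_norm _
  have e : ⟪ψ, (g : Lp ℂ 2 γ)⟫_ℂ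
      = pairing γ (ha.toLp a) g - Complex.I * pairing γ (hb.toLp b) g := by
    unfold pairing
    rw [L2.inner_def, ← integral_const_mul, ← integral_sub (pairing_integrable γ _ _)
      ((pairing_integrable γ _ _).const_mul _)]
    refine integral_congr_ae ?_
    filter_upwards [ha.coeFn_toLp, hb.coeFn_toLp, hψ] with x h1 h2 h3
    rw [h1, h2, h3, RCLike.inner_apply]
    simp
    ring
  rw [e]
  refine (norm_sub_le _ _).trans ?_
  rw [norm_mul, Complex.norm_I, one_mul]
  have h1 := h _ (hmem a ha)
  have h2 := h _ (hmem b hb)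
  have h3 : C * ‖ha.toLp a‖ ≤ C * ‖ψ‖ := by gcongr
  have h4 : C * ‖hb.toLp b‖ ≤ C * ‖ψ‖ := by gcongr
  linarith

/-- The bound for `⟪ψ, g⟫` passes from the span of the dual to its closure, where `ψ = g` is
allowed. -/
theorem norm_le_of_norm_pairing_le {g : CameronMartinC γ} {C : ℝ} (hC : 0 ≤ C)
    (h : ∀ φ ∈ reproducingSpace γ, ‖pairing γ φ g‖ ≤ C * ‖φ‖) : ‖g‖ ≤ 2 * C := by
  have hcl : IsClosed {ψ : Lp ℂ 2 γ | ‖⟪ψ, (g : Lp ℂ 2 γ)⟫_ℂ‖ ≤ 2 * C * ‖ψ‖} :=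
    isClosed_le (by fun_prop) (by fun_prop)
  have hg : (g : Lp ℂ 2 γ) ∈ {ψ : Lp ℂ 2 γ | ‖⟪ψ, (g : Lp ℂ 2 γ)⟫_ℂ‖ ≤ 2 * C * ‖ψ‖} := by
    refine closure_minimal ?_ hcl g.2
    intro ψ hψ
    obtain ⟨a, b, hab⟩ := exists_dual_of_mem_span hψ
    exact norm_inner_le_of_norm_pairing_le hC h hab
  have hg' : ‖⟪(g : Lp ℂ 2 γ), (g : Lp ℂ 2 γ)⟫_ℂ‖ ≤ 2 * C * ‖(g : Lp ℂ 2 γ)‖ := hg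
  rw [inner_self_eq_norm_sq_to_K, norm_pow, RCLike.norm_ofReal, abs_norm] at hg'
  rw [Submodule.coe_norm]
  rcases (norm_nonneg (g : Lp ℂ 2 γ)).eq_or_lt with h0 | h0
  · rw [← h0]; positivity
  · rw [sq] at hg'
    exact le_of_mul_le_mul_right hg' h0

/-- Every element of the Lipschitz core on `Ω` is the restriction of one on the whole space. -/
theorem exists_restrict_eq_of_mem_lipschitzGraph [IsFiniteMeasure γ] [OpensMeasurableSpace X]
    [SecondCountableTopology X] (h2 : MemLp id 2 γ) {Ω : Set X} {w : L2Pair γ Ω}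
    (hw : w ∈ lipschitzGraph γ Ω) :
    ∃ v ∈ lipschitzGraph γ Set.univ, L2Pair.restrict (Set.subset_univ Ω) v = w := by
  obtain ⟨u, G, ⟨K, hK⟩, hG, hd, h3, h4⟩ := hw
  have hu : MemLp u 2 (γ.restrict Set.univ) := (memLp_of_lipschitzWith h2 hK).restrict _
  -- Membership of `w` in the core controls `G` in `L²` on `Ω` only; the Lipschitz constant bounds
  -- it almost everywhere on `X`.
  have hGL : MemLp G 2 (γ.restrict Set.univ) := by
    refine MemLp.restrict _ (MemLp.of_bound hG (2 * (K * (eLpNorm id 2 γ).toReal)) ?_)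
    filter_upwards [hd] with x hx
    exact norm_le_of_norm_pairing_le (by positivity) fun φ hφ =>
      norm_le_of_lipschitzWith_of_isHGradientAt h2 hK hx hφ
  refine ⟨L2Pair.mk (hu.toLp u) (hGL.toLp G),
    ⟨u, G, ⟨K, hK⟩, hG, hd, hu.coeFn_toLp, hGL.coeFn_toLp⟩, ?_⟩
  have hac := Measure.absolutelyContinuous_of_le
    (Measure.restrict_mono (μ := γ) (Set.subset_univ Ω) le_rfl)
  refine L2Pair.ext (Lp.ext ?_) (Lp.ext ?_)
  · exact ((coeFn_restrictLp _ _).trans (hac.ae_le hu.coeFn_toLp)).trans h3.symm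
  · exact ((coeFn_restrictLp _ _).trans (hac.ae_le hGL.coeFn_toLp)).trans h4.symm

theorem denseRange_restrict_univ [IsFiniteMeasure γ] [OpensMeasurableSpace X]
    [SecondCountableTopology X] (h2 : MemLp id 2 γ) (Ω : Set X) :
    DenseRange (W12.restrict (γ := γ) (Set.subset_univ Ω)) := by
  intro z
  rw [Metric.mem_closure_iff]
  intro ε hε
  obtain ⟨w, hw, hzw⟩ := Metric.mem_closure_iff.1 z.2 ε hε
  obtain ⟨v, hv, rfl⟩ := exists_restrict_eq_of_mem_lipschitzGraph h2 hw
  exact ⟨_, ⟨⟨v, Submodule.le_topologicalClosure _ hv⟩, rfl⟩, hzw⟩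

end GradientBound

/-! ### Characters and density of `W^{1,2}` in `L²`. -/

section Characters

variable {X : Type*} [NormedAddCommGroup X] [NormedSpace ℝ X]

theorem norm_exp_dual (l : StrongDual ℝ X) (x : X) : ‖Complex.exp (l x * Complex.I)‖ = 1 :=
  Complex.norm_exp_ofReal_mul_I _

theorem lipschitzWith_exp_dual (l : StrongDual ℝ X) :
    LipschitzWith ‖l‖₊ fun x => Complex.exp (l x * Complex.I) := by
  refine LipschitzWith.of_dist_le_mul fun x y => ?_
  have e : Complex.exp (l x * Complex.I) - Complex.exp (l y * Complex.I)
      = Complex.exp (l y * Complex.I) * (Complex.exp (Complex.I * (l (x - y) : ℝ)) - 1) := by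
    rw [mul_sub, ← Complex.exp_add, map_sub]
    push_cast
    ring_nf
  rw [dist_eq_norm, e, norm_mul, norm_exp_dual, one_mul, dist_eq_norm, coe_nnnorm]
  exact Real.norm_exp_I_mul_ofReal_sub_one_le.trans (l.le_opNorm _)

variable [MeasurableSpace X]

/-- The class of `l` in `L²` is its own gradient along `H`: `l` passes under the Bochner integral
defining `h`. -/
theorem exists_dual_class [CompleteSpace X] {γ : Measure X} (h2 : MemLp id 2 γ) (l : StrongDual ℝ X) :
    ∃ g : CameronMartinC γ, ∀ φ : Lp ℝ 2 γ, pairing γ φ g = l (cmVector γ φ) := by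
  have hl : MemLp (fun x => (l x : ℂ)) 2 γ := (l.comp_memLp' h2).ofReal
  refine ⟨⟨hl.toLp _, Submodule.le_topologicalClosure _
    (Submodule.subset_span ⟨l, hl.coeFn_toLp⟩)⟩, fun φ => ?_⟩
  unfold pairing cmVector
  rw [← l.integral_comp_comm (integrable_smul_id h2 φ), ← integral_complex_ofReal]
  refine integral_congr_ae ?_
  filter_upwards [hl.coeFn_toLp] with x hx
  simp [hx]

theorem integral_exp_withDensity {ν : Measure X} {f : X → ℝ} (hf : Integrable f ν)
    (l : StrongDual ℝ X) :
    charFunDual (ν.withDensity fun x => ENNReal.ofReal (f x)) l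
      = ∫ x, ((max (f x) 0 : ℝ) : ℂ) * Complex.exp (l x * Complex.I) ∂ν := by
  rw [charFunDual_apply, integral_withDensity_eq_integral_toReal_smul₀
    hf.aemeasurable.ennreal_ofReal (.of_forall fun _ => ENNReal.ofReal_lt_top)]
  refine integral_congr_ae (.of_forall fun x => ?_)
  simp only [ENNReal.toReal_ofReal', Complex.real_smul]

variable [BorelSpace X]

theorem integrable_mul_exp_dual {ν : Measure X} {f : X → ℂ} (hf : Integrable f ν)
    (l : StrongDual ℝ X) : Integrable (fun x => f x * Complex.exp (l x * Complex.I)) ν :=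
  hf.mul_bdd (c := 1) (by fun_prop) (.of_forall fun x => (norm_exp_dual l x).le)

variable [CompleteSpace X] [SecondCountableTopology X]

/-- An integrable real function all of whose integrals against characters vanish is zero. -/
theorem ae_eq_zero_of_integral_mul_exp_eq_zero_real {ν : Measure X} {f : X → ℝ}
    (hf : Integrable f ν)
    (h : ∀ l : StrongDual ℝ X, ∫ x, (f x : ℂ) * Complex.exp (l x * Complex.I) ∂ν = 0) :
    f =ᵐ[ν] 0 := by
  have := isFiniteMeasure_withDensity_ofReal hf.2
  have := isFiniteMeasure_withDensity_ofReal hf.neg.2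
  -- The positive and negative parts of `f` are densities of two finite measures with equal
  -- characteristic functionals.
  have heq : (ν.withDensity fun x => ENNReal.ofReal (f x))
      = ν.withDensity fun x => ENNReal.ofReal ((-f) x) := by
    refine Measure.ext_of_charFunDual (funext fun l => ?_)
    have h1 : Integrable (fun x => ((max (f x) 0 : ℝ) : ℂ) * Complex.exp (l x * Complex.I)) ν :=
      integrable_mul_exp_dual hf.pos_part.ofReal l
    have h2 : Integrable
        (fun x => ((max ((-f) x) 0 : ℝ) : ℂ) * Complex.exp (l x * Complex.I)) ν :=
      integrable_mul_exp_dual hf.neg.pos_part.ofReal l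
    rw [integral_exp_withDensity hf, integral_exp_withDensity hf.neg, ← sub_eq_zero,
      ← integral_sub h1 h2, ← h l]
    refine integral_congr_ae (.of_forall fun x => ?_)
    simp only [← sub_mul, ← Complex.ofReal_sub, Pi.neg_apply]
    rw [max_zero_sub_max_neg_zero_eq_self]
  rw [withDensity_eq_iff hf.aemeasurable.ennreal_ofReal hf.neg.aemeasurable.ennreal_ofReal
    hf.lintegral_lt_top.ne] at heq
  filter_upwards [heq] with x hx
  have := congrArg ENNReal.toReal hx
  simp only [ENNReal.toReal_ofReal', Pi.neg_apply] at this
  have h3 := max_zero_sub_max_neg_zero_eq_self (f x)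
  rw [this, sub_self] at h3
  exact h3.symm

/-- Conjugating the hypothesis at `-l` gives it for the conjugate of `f`, hence for the real and
imaginary parts. -/
theorem ae_eq_zero_of_integral_mul_exp_eq_zero {ν : Measure X} {f : X → ℂ} (hf : Integrable f ν)
    (h : ∀ l : StrongDual ℝ X, ∫ x, f x * Complex.exp (l x * Complex.I) ∂ν = 0) :
    f =ᵐ[ν] 0 := by
  have hconj : ∀ l : StrongDual ℝ X,
      ∫ x, (starRingEnd ℂ) (f x) * Complex.exp (l x * Complex.I) ∂ν = 0 := fun l => by
    have := congrArg (starRingEnd ℂ) (h (-l))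
    rw [← integral_conj, map_zero] at this
    rw [← this]
    refine integral_congr_ae (.of_forall fun x => ?_)
    simp [← Complex.exp_conj]
  have hic : Integrable (fun x => (starRingEnd ℂ) (f x)) ν :=
    Complex.conjCLE.toContinuousLinearMap.integrable_comp hf
  have hre := ae_eq_zero_of_integral_mul_exp_eq_zero_real hf.re fun l => by
    have e : ∀ x, (((f x).re : ℝ) : ℂ) * Complex.exp (l x * Complex.I)
        = 2⁻¹ * (f x * Complex.exp (l x * Complex.I)
          + (starRingEnd ℂ) (f x) * Complex.exp (l x * Complex.I)) := fun x => by
      rw [Complex.re_eq_add_conj]; ring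
    simp only [RCLike.re_to_complex, e]
    rw [integral_const_mul, integral_add (integrable_mul_exp_dual hf l)
      (integrable_mul_exp_dual hic l), h, hconj, add_zero, mul_zero]
  have him := ae_eq_zero_of_integral_mul_exp_eq_zero_real hf.im fun l => by
    have e : ∀ x, (((f x).im : ℝ) : ℂ) * Complex.exp (l x * Complex.I)
        = (2 * Complex.I)⁻¹ * (f x * Complex.exp (l x * Complex.I)
          - (starRingEnd ℂ) (f x) * Complex.exp (l x * Complex.I)) := fun x => by
      rw [Complex.im_eq_sub_conj]; ring
    simp only [RCLike.im_to_complex, e]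
    rw [integral_const_mul, integral_sub (integrable_mul_exp_dual hf l)
      (integrable_mul_exp_dual hic l), h, hconj, sub_zero, mul_zero]
  filter_upwards [hre, him] with x h1 h2
  exact Complex.ext h1 h2

variable {γ : Measure X}

/-- A character is bounded and Lipschitz, with bounded gradient `i exp(i l)` times the class of `l`.
-/
theorem exists_exp_mem_W12 [IsFiniteMeasure γ] (h2 : MemLp id 2 γ) (Ω : Set X)
    (l : StrongDual ℝ X) :
    ∃ w : W12 γ Ω, W12.embed γ Ω w =ᵐ[γ.restrict Ω] fun x => Complex.exp (l x * Complex.I) := by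
  obtain ⟨g, hg⟩ := exists_dual_class h2 l
  set G : X → CameronMartinC γ := fun x => (Complex.exp (l x * Complex.I) * Complex.I) • g with hGdef
  have hG : AEStronglyMeasurable G γ := by
    have : Continuous fun x => Complex.exp (l x * Complex.I) * Complex.I := by fun_prop
    exact this.aestronglyMeasurable.smul_const g
  have hu : MemLp (fun x => Complex.exp (l x * Complex.I)) 2 (γ.restrict Ω) :=
    ((memLp_of_lipschitzWith h2 (lipschitzWith_exp_dual l))).restrict Ω
  have hGL : MemLp G 2 (γ.restrict Ω) :=
    (MemLp.of_bound hG ‖g‖ (.of_forall fun x => by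
      rw [hGdef, norm_smul, norm_mul, norm_exp_dual, Complex.norm_I, one_mul, one_mul])).restrict Ω
  refine ⟨⟨L2Pair.mk (hu.toLp _) (hGL.toLp G), Submodule.le_topologicalClosure _
    ⟨_, G, ⟨_, lipschitzWith_exp_dual l⟩, hG, .of_forall fun x φ _ => ?_, hu.coeFn_toLp,
      hGL.coeFn_toLp⟩⟩, hu.coeFn_toLp⟩
  rw [hGdef, pairing_smul, hg]
  have h1 : HasDerivAt (fun t : ℝ => l (x + t • cmVector γ φ)) (l (cmVector γ φ)) 0 := by
    simp only [map_add, map_smul, smul_eq_mul]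
    simpa using ((hasDerivAt_id (0 : ℝ)).mul_const (l (cmVector γ φ))).const_add (l x)
  have h3 := (h1.ofReal_comp.mul_const Complex.I).cexp
  simp only [zero_smul, add_zero] at h3
  convert h3 using 1
  ring

/-- A function in `L²` orthogonal to the range is orthogonal to all characters, so its conjugate
vanishes almost everywhere. -/
theorem denseRange_embed [IsFiniteMeasure γ] (h2 : MemLp id 2 γ) (Ω : Set X) :
    DenseRange (W12.embed γ Ω) := by
  have h : (W12.embed γ Ω).range.topologicalClosure = ⊤ := by
    rw [Submodule.topologicalClosure_eq_top_iff, Submodule.eq_bot_iff]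
    intro f hf
    rw [Submodule.mem_orthogonal'] at hf
    have hint : Integrable f (γ.restrict Ω) := (Lp.memLp f).integrable (by norm_num)
    have hic : Integrable (fun x => (starRingEnd ℂ) (f x)) (γ.restrict Ω) :=
      Complex.conjCLE.toContinuousLinearMap.integrable_comp hint
    have h0 := ae_eq_zero_of_integral_mul_exp_eq_zero hic fun l => by
      obtain ⟨w, hw⟩ := exists_exp_mem_W12 h2 Ω l
      have := hf _ ⟨w, rfl⟩
      change ⟪f, W12.embed γ Ω w⟫_ℂ = 0 at this
      rw [L2.inner_def] at this
      rw [← this]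
      refine integral_congr_ae ?_
      filter_upwards [hw] with x hx
      rw [hx, RCLike.inner_apply, mul_comm]
    refine Lp.ext ?_
    filter_upwards [h0, Lp.coeFn_zero ℂ 2 (γ.restrict Ω)] with x hx h4
    rw [h4]
    simpa using hx
  intro x
  have : x ∈ (W12.embed γ Ω).range.topologicalClosure := h ▸ Submodule.mem_top
  exact this

end Characters

/-! ### Application to the Ornstein-Uhlenbeck operators. -/

section Convergence

variable {X : Type*} [NormedAddCommGroup X] [NormedSpace ℝ X] [MeasurableSpace X]

theorem isResolvent_ouGraph (γ : Measure X) (Ω : Set X) {z : ℂ} (hz : z ∈ Complex.slitPlane) :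
    IsResolvent (ouGraph γ Ω) z (formResolvent (W12.embed γ Ω) *
      unitCalc (formResolvent (W12.embed γ Ω)) (resolventFactor z)) := by
  rw [ouGraph_eq]
  exact isResolvent_graphOfResolvent (isPositive_formResolvent _)
    (norm_formResolvent_le W12.norm_embed_le) hz

variable {γ : Measure X} {Ω : Set X} {Ωn : ℕ → Set X}

theorem isRestrictionSystem_restrictLp {X : Type*} [MeasurableSpace X] {γ : Measure X}
    {Ω : Set X} {Ωn : ℕ → Set X} (hs : ∀ n, Ω ⊆ Ωn n)
    (hlim : Tendsto (fun n => γ (Ωn n \ Ω)) atTop (𝓝 0)) :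
    IsRestrictionSystem
      (fun n => restrictLp ℂ (Measure.restrict_mono (μ := γ) (Set.subset_univ (Ωn n)) le_rfl))
      (restrictLp ℂ (Measure.restrict_mono (μ := γ) (Set.subset_univ Ω) le_rfl))
      (fun n => restrictLp ℂ (Measure.restrict_mono (hs n) le_rfl)) where
  apply_apply _ _ := restrictLp_restrictLp _ _ _ _
  norm_le _ := norm_restrictLp_le _
  tendsto_norm f := tendsto_norm_restrictLp f Measure.restrict_univ hs hlim _ _

theorem isRestrictionSystem_W12_restrict (hs : ∀ n, Ω ⊆ Ωn n)
    (hlim : Tendsto (fun n => γ (Ωn n \ Ω)) atTop (𝓝 0)) :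
    IsRestrictionSystem (fun n => W12.restrict (γ := γ) (Set.subset_univ (Ωn n)))
      (W12.restrict (Set.subset_univ Ω)) (fun n => W12.restrict (hs n)) where
  apply_apply _ w := Subtype.ext (L2Pair.restrict_restrict (hs _)
    (Set.subset_univ _) (Set.subset_univ Ω) (w : L2Pair γ Set.univ))
  norm_le _ := W12.norm_restrict_le _
  tendsto_norm w := by
    have hnorm : ∀ {A : Set X} (v : W12 γ A), ‖v‖
        = √(‖(v : L2Pair γ A).fn‖ ^ 2 + ‖(v : L2Pair γ A).grad‖ ^ 2) := fun v => by
      rw [← L2Pair.norm_sq_eq, Real.sqrt_sq (norm_nonneg _)]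
      rfl
    simp only [hnorm]
    exact (((tendsto_norm_restrictLp (w : L2Pair γ Set.univ).fn Measure.restrict_univ hs hlim
      (fun n => Measure.restrict_mono (Set.subset_univ (Ωn n)) le_rfl)
      (Measure.restrict_mono (Set.subset_univ Ω) le_rfl)).pow 2).add
      ((tendsto_norm_restrictLp (w : L2Pair γ Set.univ).grad Measure.restrict_univ hs hlim
      (fun n => Measure.restrict_mono (Set.subset_univ (Ωn n)) le_rfl)
      (Measure.restrict_mono (Set.subset_univ Ω) le_rfl)).pow 2)).sqrt

variable [SecondCountableTopology X] [BorelSpace X] [IsFiniteMeasure γ]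

/-- Covers resolvents and semigroups together: the functions in `W^{1,2}` behind `R k(R) f` are `ι*
k(R) f`, to which the abstract convergence applies. -/
theorem tendstoW12_unitCalc (h2 : MemLp id 2 γ) (hs : ∀ n, Ω ⊆ Ωn n)
    (hlim : Tendsto (fun n => γ (Ωn n \ Ω)) atTop (𝓝 0)) {k : ℝ → ℂ}
    (hk : ContinuousOn k (Set.Icc 0 1)) (f : Lp ℂ 2 γ) :
    TendstoW12 γ Ω
      (fun n => restrictL2 (Measure.restrict_mono (hs n) le_rfl)
        ((formResolvent (W12.embed γ (Ωn n)) *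
          unitCalc (formResolvent (W12.embed γ (Ωn n))) k)
          (restrictL2 Measure.restrict_le_self f)))
      ((formResolvent (W12.embed γ Ω) * unitCalc (formResolvent (W12.embed γ Ω)) k)
        (restrictL2 Measure.restrict_le_self f)) := by
  have hJ := isRestrictionSystem_restrictLp hs hlim
  have hP := isRestrictionSystem_W12_restrict hs hlim
  have key := hP.tendsto_of_discreteTendsto
    (discreteTendsto_unitCalc (ι := W12.embed γ Set.univ) (ιn := fun n => W12.embed γ (Ωn n))
      (ι' := W12.embed γ Ω) hJ hP (denseRange_restrict_univ h2 Ω) (fun _ => W12.norm_embed_le)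
      W12.norm_embed_le (fun _ => rfl) (fun _ _ => rfl) (fun _ => rfl) hk
      (restrictLp ℂ Measure.restrict_le_self f))
  have hf : ∀ A : Set X, restrictLp ℂ (Measure.restrict_mono (μ := γ) (Set.subset_univ A) le_rfl)
      (restrictLp ℂ Measure.restrict_le_self f) = restrictL2 Measure.restrict_le_self f :=
    fun A => restrictLp_restrictLp _ _ Measure.restrict_le_self f
  simp only [hf] at key
  exact ⟨_, _, fun _ => rfl, rfl, key⟩

theorem isSemigroupGeneratedBy_ouGraph [CompleteSpace X] (h2 : MemLp id 2 γ) (Ω : Set X) :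
    IsSemigroupGeneratedBy (ouGraph γ Ω) (heatSemigroup (formResolvent (W12.embed γ Ω))) := by
  rw [ouGraph_eq]
  exact isSemigroupGeneratedBy_heatSemigroup (isPositive_formResolvent _)
    (norm_formResolvent_le W12.norm_embed_le) (denseRange_formResolvent (denseRange_embed h2 Ω))

end Convergence

end WienerOU

theorem proposition3p3 {X : Type*} [NormedAddCommGroup X] [NormedSpace ℝ X] [CompleteSpace X]
    [SecondCountableTopology X] [MeasurableSpace X] [BorelSpace X]
    (γ : Measure X) [IsGaussian γ]
    (h_centred : ∀ l : StrongDual ℝ X, ∫ x, l x ∂γ = 0)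
    (h_nondegenerate : ∀ l : StrongDual ℝ X, l ≠ 0 → 0 < ∫ x, l x ^ 2 ∂γ)
    (Ω : Set X) (h_open : IsOpen Ω) (h_convex : Convex ℝ Ω)
    (Ωn : ℕ → Set X) (h_cyl : ∀ n, WienerOU.IsSmoothConvexCylinder (Ωn n))
    (h_sub : ∀ n, Ω ⊆ Ωn n)
    (h_lim : Tendsto (fun n => γ (Ωn n \ Ω)) atTop (𝓝 0)) :
    (∀ z ∈ Complex.slitPlane,
      ∃ (R : WienerOU.L2 γ Ω →L[ℂ] WienerOU.L2 γ Ω)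
        (Rn : ∀ n, WienerOU.L2 γ (Ωn n) →L[ℂ] WienerOU.L2 γ (Ωn n)),
        WienerOU.IsResolvent (WienerOU.ouGraph γ Ω) z R ∧
        (∀ n, WienerOU.IsResolvent (WienerOU.ouGraph γ (Ωn n)) z (Rn n)) ∧
        ∀ f : Lp ℂ 2 γ, WienerOU.TendstoW12 γ Ω
          (fun n => WienerOU.restrictL2 (Measure.restrict_mono (h_sub n) le_rfl)
            (Rn n (WienerOU.restrictL2 Measure.restrict_le_self f)))
          (R (WienerOU.restrictL2 Measure.restrict_le_self f))) ∧
    ∃ (T : ℝ≥0 → WienerOU.L2 γ Ω →L[ℂ] WienerOU.L2 γ Ω)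
      (Tn : ∀ n, ℝ≥0 → WienerOU.L2 γ (Ωn n) →L[ℂ] WienerOU.L2 γ (Ωn n)),
      WienerOU.IsSemigroupGeneratedBy (WienerOU.ouGraph γ Ω) T ∧
      (∀ n, WienerOU.IsSemigroupGeneratedBy (WienerOU.ouGraph γ (Ωn n)) (Tn n)) ∧
      ∀ (u₀ : Lp ℂ 2 γ) (t : ℝ≥0), 0 < t → WienerOU.TendstoW12 γ Ω
        (fun n => WienerOU.restrictL2 (Measure.restrict_mono (h_sub n) le_rfl)
          (Tn n t (WienerOU.restrictL2 Measure.restrict_le_self u₀)))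
        (T t (WienerOU.restrictL2 Measure.restrict_le_self u₀)) := by
  -- Gaussian measures have finite second moment (Fernique).
  have h2 : MemLp id 2 γ := IsGaussian.memLp_id γ 2 (by simp)
  have hmain := fun {k : ℝ → ℂ} (hk : ContinuousOn k (Set.Icc 0 1)) (f : Lp ℂ 2 γ) =>
    WienerOU.tendstoW12_unitCalc h2 h_sub h_lim hk f
  refine ⟨fun z hz => ⟨_, _, WienerOU.isResolvent_ouGraph γ Ω hz,
    fun n => WienerOU.isResolvent_ouGraph γ (Ωn n) hz,
    fun f => hmain (WienerOU.continuousOn_resolventFactor hz) f⟩, _, _,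
    WienerOU.isSemigroupGeneratedBy_ouGraph h2 Ω,
    fun n => WienerOU.isSemigroupGeneratedBy_ouGraph h2 (Ωn n), fun u₀ t ht => ?_⟩
  -- With the factor `R` split off, the semigroup at `t > 0` is the case `k = heatQuotient t` of
  -- `hmain`.
  have hS := fun A : Set X => WienerOU.heatSemigroup_eq
    (WienerOU.isPositive_formResolvent (WienerOU.W12.embed γ A))
    (WienerOU.norm_formResolvent_le WienerOU.W12.norm_embed_le) ht
  simp only [hS]
  exact hmain
    (Complex.continuous_ofReal.comp_continuousOn (WienerOU.continuousOn_heatQuotient ht)) u₀
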